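/- Let $n\in\mathbb N$, let $\Omega\subset\mathbb R^n$ be open, $s\in(0,1)$, and let $q:\Omega\to[1,\infty)$ and $p:\Omega\times\Omega\to[1,\infty)$ be measurable with $1<q^-\le q^+<\infty$ and $1<p^-\le p^+<\infty$ (essential infima and suprema). For measurable $u:\Omega\to\mathbb R$ let $$\rho(u)=\int_\Omega|u(x)|^{q(x)}\,dx+\int_\Omega\int_\Omega\frac{|u(x)-u(y)|^{p(x,y)}}{|x-y|^{n+sp(x,y)}}\,dx\,dy ,$$ let $\mathcal W(\Omega)$ be the space of all (classes of) $u\in L^{q(\cdot)}(\Omega)$ with $\frac{|u(x)-u(y)|}{|x-y|^{s+n/p(x,y)}}\in L^{p(\cdot,\cdot)}(\Omega\times\Omega)$, and put $$\|u\|=\|u\|_{L^{q(\cdot)}(\Omega)}+\inf\Big\{\lambda>0:\int_\Omega\int_\Omega\frac{|u(x)-u(y)|^{p(x,y)}}{\lambda^{p(x,y)}|x-y|^{n+sp(x,y)}}\,dx\,dy\le1\Big\},\qquad \|u\|_\rho=\inf\{\lambda>0:\rho(u/\lambda)\le1\},$$ where $\|\cdot\|_{L^{q(\cdot)}(\Omega)}$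 is the Luxembourg norm. Let $\widetilde{\mathcal W}(\Omega)$ be the closure in $\mathcal W(\Omega)$ of the set of those elements of $\mathcal W(\Omega)$ that are restrictions of continuous functions with compact support on $\overline\Omega$. For a relatively open $O\subset\overline\Omega$ let $C(O)=\inf\{\rho(u):u\in\widetilde{\mathcal W}(\Omega),\ u\ge1\text{ a.e. on }O\cap\Omega\}$ (with $\inf\emptyset=\infty$), and for any $A\subset\overline\Omega$ let $C(A)=\inf\{C(O):O\supset A\text{ relatively open in }\overline\Omega\}$. A function $w:\overline\Omega\to\mathbb R$ is relatively quasicontinuous if for every $\varepsilon>0$ there is a relatively open $O\subset\overline\Omega$ with $C(O)<\varepsilon$ such that the restriction of $w$ to $\overline\Omega\setminus O$ is continuous. Let $\widetilde{\mathcal W}_0(\Omega)$ be the set of all classes $u$, modulo equality a.e. in $\Omega$, for which there is a relatively quasicontinuous $\tilde u:\overline\Omega\to\mathbb R$ with $\tilde u|_\Omega\in\widetilde{\mathcal W}(\Omega)$, $\tilde u=u$ a.e. in $\Omega$, and $\tilde u=0$ on $\partial\Omega\setminus P$ for some $P\subset\partial\Omega$ with $C(P)=0$; call every such $\tilde u$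 a zero trace representative of $u$. Then $\widetilde{\mathcal W}_0(\Omega)$ is a linear space, and a lattice: with $u$ and $v$ it contains the pointwise maximum $\max\{u,v\}$ and minimum $\min\{u,v\}$. For $u\in\widetilde{\mathcal W}_0(\Omega)$ one has $\|u\|=\|\tilde u\|$ and $\|u\|_\rho=\|\tilde u\|_\rho$ for every zero trace representative $\tilde u$ of $u$, and $\|u\|_\rho\le\|u\|\le2\|u\|_\rho$. With either of the equivalent norms $\|\cdot\|$ and $\|\cdot\|_\rho$, $\widetilde{\mathcal W}_0(\Omega)$ is a separable and reflexive Banach space; with the norm $\|\cdot\|_\rho$ it is, moreover, uniformly convex. -/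

import Mathlib

open MeasureTheory Set
open scoped ENNReal

noncomputable section

namespace FracSobolev

section VariableLebesgue

variable {α : Type*} [MeasurableSpace α]

/-- `r` is a (Lebesgue) measurable exponent with `1 < r⁻ ≤ r⁺ < ∞`, where `r⁻` and `r⁺` are the
essential infimum and the essential supremum of `r` with respect to `μ`. -/
def IsExponent (μ : Measure α) (r : α → ℝ) : Prop :=
  AEMeasurable r μ ∧ ∃ a b : ℝ, 1 < a ∧ ∀ᵐ x ∂μ, a ≤ r x ∧ r x ≤ b

/-- The modular `∫ |f(x)|^{r(x)} dμ(x)`. -/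
def lebModular (μ : Measure α) (r : α → ℝ) (f : α → ℝ) : ℝ≥0∞ :=
  ∫⁻ x, ENNReal.ofReal (|f x| ^ r x) ∂μ

/-- `f` is (a representative of an element) in the variable exponent Lebesgue space `L^{r(.)}`. -/
def MemLeb (μ : Measure α) (r : α → ℝ) (f : α → ℝ) : Prop :=
  AEStronglyMeasurable f μ ∧ ∃ t : ℝ, 0 < t ∧ lebModular μ r (fun x => t * f x) < ∞

/-- The Luxembourg norm of `L^{r(.)}`. -/
def lebNorm (μ : Measure α) (r : α → ℝ) (f : α → ℝ) : ℝ :=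
  sInf {t : ℝ | 0 < t ∧ lebModular μ r (fun x => f x / t) ≤ 1}

end VariableLebesgue

variable {n : ℕ}

/-- The space `ℝⁿ` with its Euclidean norm. -/
abbrev E (n : ℕ) : Type := EuclideanSpace ℝ (Fin n)

/-- Lebesgue measure on `Ω`. -/
abbrev leb (Ω : Set (E n)) : Measure (E n) := volume.restrict Ω

/-- Lebesgue measure on `Ω × Ω`. -/
abbrev leb₂ (Ω : Set (E n)) : Measure (E n × E n) := (leb Ω).prod (leb Ω)

/- Functions on `Ω`, on its closure, and exponents are written as total functions on `ℝⁿ`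
(on `ℝⁿ × ℝⁿ`) of which only the values on the set in question are used. -/

/-- `u ∈ W^{s,q(.),p(.,.)}(Ω)`. -/
def MemW (Ω : Set (E n)) (s : ℝ) (q : E n → ℝ) (p : E n × E n → ℝ) (u : E n → ℝ) : Prop :=
  MemLeb (leb Ω) q u ∧
    MemLeb (leb₂ Ω) p (fun z => |u z.1 - u z.2| / ‖z.1 - z.2‖ ^ (s + n / p z))

/-- The Gagliardo modular `∫_Ω ∫_Ω |u(x) - u(y)|^{p(x,y)} / |x - y|^{n + s p(x,y)} dx dy`. -/
def gagModular (Ω : Set (E n)) (s : ℝ) (p : E n × E n → ℝ) (u : E n → ℝ) : ℝ≥0∞ :=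
  ∫⁻ z, ENNReal.ofReal (|u z.1 - u z.2| ^ p z / ‖z.1 - z.2‖ ^ (n + s * p z)) ∂(leb₂ Ω)

/-- The modular of `W^{s,q(.),p(.,.)}(Ω)`. -/
def modular (Ω : Set (E n)) (s : ℝ) (q : E n → ℝ) (p : E n × E n → ℝ) (u : E n → ℝ) : ℝ≥0∞ :=
  lebModular (leb Ω) q u + gagModular Ω s p u

/-- The Gagliardo seminorm. -/
def gagSeminorm (Ω : Set (E n)) (s : ℝ) (p : E n × E n → ℝ) (u : E n → ℝ) : ℝ :=
  sInf {t : ℝ | 0 < t ∧ gagModular Ω s p (fun x => u x / t) ≤ 1}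

/-- The norm `‖u‖_{L^{q(.)}} + [u]` of `W^{s,q(.),p(.,.)}(Ω)`. -/
def sumNorm (Ω : Set (E n)) (s : ℝ) (q : E n → ℝ) (p : E n × E n → ℝ) (u : E n → ℝ) : ℝ :=
  lebNorm (leb Ω) q u + gagSeminorm Ω s p u

/-- The norm of `W^{s,q(.),p(.,.)}(Ω)` that is induced by the modular. -/
def modularNorm (Ω : Set (E n)) (s : ℝ) (q : E n → ℝ) (p : E n × E n → ℝ) (u : E n → ℝ) : ℝ :=
  sInf {t : ℝ | 0 < t ∧ modular Ω s q p (fun x => u x / t) ≤ 1}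

/-- `v` is continuous on the closure of `Ω`, with compact support in the closure of `Ω`. -/
def IsContCompact (Ω : Set (E n)) (v : E n → ℝ) : Prop :=
  ContinuousOn v (closure Ω) ∧
    ∃ K : Set (E n), IsCompact K ∧ K ⊆ closure Ω ∧ ∀ x ∈ closure Ω \ K, v x = 0

/-- `u ∈ W̃^{s,q(.),p(.,.)}(Ω)`, the closure in `W^{s,q(.),p(.,.)}(Ω)` of the functions that are
continuous with compact support on the closure of `Ω`. -/
def MemWTilde (Ω : Set (E n)) (s : ℝ) (q : E n → ℝ) (p : E n × E n → ℝ) (u : E n → ℝ) : Prop :=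
  MemW Ω s q p u ∧ ∀ ε : ℝ, 0 < ε →
    ∃ v : E n → ℝ, MemW Ω s q p v ∧ IsContCompact Ω v ∧ sumNorm Ω s q p (fun x => u x - v x) < ε

/-- `O` is a relatively open subset of the closure of `Ω`. -/
def IsRelOpen (Ω O : Set (E n)) : Prop :=
  ∃ U : Set (E n), IsOpen U ∧ O = U ∩ closure Ω

/-- The relative capacity of a relatively open set `O`: the infimum of the modular over all
`u ∈ W̃` with `u ≥ 1` a.e. on `O`, that is, a.e. on `O ∩ Ω`, where `u` is defined.
It is `∞` if there is no such `u`. -/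
def openCapacity (Ω : Set (E n)) (s : ℝ) (q : E n → ℝ) (p : E n × E n → ℝ) (O : Set (E n)) :
    ℝ≥0∞ :=
  ⨅ (u : E n → ℝ) (_ : MemWTilde Ω s q p u ∧ ∀ᵐ x ∂(leb Ω), x ∈ O → 1 ≤ u x), modular Ω s q p u

/-- The relative capacity of a subset `A` of the closure of `Ω`. -/
def capacity (Ω : Set (E n)) (s : ℝ) (q : E n → ℝ) (p : E n × E n → ℝ) (A : Set (E n)) : ℝ≥0∞ :=
  ⨅ (O : Set (E n)) (_ : IsRelOpen Ω O ∧ A ⊆ O), openCapacity Ω s q p O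

/-- `u` is relatively quasicontinuous on the closure of `Ω`. -/
def IsQuasicontinuous (Ω : Set (E n)) (s : ℝ) (q : E n → ℝ) (p : E n × E n → ℝ)
    (u : E n → ℝ) : Prop :=
  ∀ ε : ℝ≥0∞, 0 < ε → ∃ O : Set (E n), IsRelOpen Ω O ∧ capacity Ω s q p O < ε ∧
    ContinuousOn u (closure Ω \ O)

/-- `u = 0` relatively quasi everywhere in the complement of `Ω`. The capacity being defined for
subsets of the closure of `Ω` only (it is `∞` for other sets), the exceptional set is a part of
the boundary of `Ω`. -/
def IsZeroOutside (Ω : Set (E n)) (s : ℝ) (q : E n → ℝ) (p : E n × E n → ℝ)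
    (u : E n → ℝ) : Prop :=
  ∃ P : Set (E n), P ⊆ Ωᶜ ∧ capacity Ω s q p P = 0 ∧ ∀ x ∈ Ωᶜ \ P, u x = 0

/-- `w` is a quasicontinuous representative in `W̃` of the function `u` on `Ω` that vanishes
relatively quasi everywhere in the complement of `Ω`. -/
def IsZeroTraceRep (Ω : Set (E n)) (s : ℝ) (q : E n → ℝ) (p : E n × E n → ℝ)
    (u w : E n → ℝ) : Prop :=
  IsQuasicontinuous Ω s q p w ∧ MemWTilde Ω s q p w ∧ w =ᵐ[leb Ω] u ∧ IsZeroOutside Ω s q p w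

/-- The zero trace space `W̃₀^{s,q(.),p(.,.)}(Ω)`, a set of classes of measurable functions on `Ω`
modulo equality a.e. in `Ω`. -/
def zeroTraceSpace (Ω : Set (E n)) (s : ℝ) (q : E n → ℝ) (p : E n × E n → ℝ) :
    Set (E n →ₘ[leb Ω] ℝ) :=
  {u | ∃ w : E n → ℝ, IsZeroTraceRep Ω s q p u w}

section Banach

variable {V : Type*} [AddCommGroup V] [Module ℝ V]

/-- The linear subspace `S` of `V`, to be normed by the function `N`. -/
def NormedBy (S : Submodule ℝ V) (_N : V → ℝ) : Type _ := S

instance (S : Submodule ℝ V) (N : V → ℝ) : AddCommGroup (NormedBy S N) :=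
  inferInstanceAs (AddCommGroup S)

instance (S : Submodule ℝ V) (N : V → ℝ) : Module ℝ (NormedBy S N) :=
  inferInstanceAs (Module ℝ S)

instance (S : Submodule ℝ V) (N : V → ℝ) : Norm (NormedBy S N) :=
  ⟨fun u => N (show S from u).1⟩

/-- `N` is a norm on `S` that makes it a separable and reflexive Banach space. -/
def IsSeparableReflexiveBanach (S : Submodule ℝ V) (N : V → ℝ) : Prop :=
  ∃ h : NormedSpace.Core ℝ (NormedBy S N),
    letI := NormedAddCommGroup.ofCore h
    letI := NormedSpace.ofCore h
    CompleteSpace (NormedBy S N) ∧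
    TopologicalSpace.SeparableSpace (NormedBy S N) ∧
    Function.Surjective (NormedSpace.inclusionInDoubleDual ℝ (NormedBy S N))

/-- `N` is a uniformly convex norm on `S`. -/
def IsUniformlyConvex (S : Submodule ℝ V) (N : V → ℝ) : Prop :=
  ∃ h : NormedSpace.Core ℝ (NormedBy S N),
    letI := NormedAddCommGroup.ofCore h
    UniformConvexSpace (NormedBy S N)

end Banach

end FracSobolev

end

/-! The modular $\rho$ is a sum of two variable exponent Lebesgue modulars, one of $u$ and one of
its fractional difference quotient, which depends linearly on $u$. All exponents lie in some $[a,b]$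
with $1<a$, so $\rho$ is convex and satisfies $\rho(cu)\le c^b\rho(u)$ for $c\ge1$. Hence smallness
in norm and in modular are equivalent, and the Luxembourg norm is at most $t$ exactly when
$\rho(u/t)\le1$.

Uniform convexity of $\|\cdot\|_\rho$ comes from a pointwise inequality (`abs_rpow_uniformConvex`):
$|x-y|^r+K|\frac{x+y}2|^r\le(\theta+\frac K2)(|x|^r+|y|^r)$ for every $\theta>0$ and all large $K$,
uniformly in $r\in[a,b]$. It integrates, survives sums, and passes to the norm
(`lux_uniformConvex`). Reflexivity follows by Milman–Pettis and is carried to the equivalent norm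
$\|\cdot\|$.

Completeness amounts to closedness under limits of rapid Cauchy sequences of zero trace
representatives (`exists_limit_zeroTrace`). The differences are small off sets of small capacity by
a weak type estimate, so the representatives converge uniformly off such sets. The limit is
therefore quasicontinuous, and it vanishes on the boundary off a countable union of sets of capacity
zero. Capacity is handled through `NormSmall`, which measures a set by the norm of a nonnegative
competitor: the triangle inequality and Fatou's lemma then give countable subadditivity.

Separability uses the nonlinear map that takes odd powers $t|t|^{r-1}$ of $u$ and of its difference
quotient. Its values lie in the separable space $L^1(\Omega)\times L^1(\Omega\times\Omega)$, and the
distance of two values there controls $\rho(u-v)$.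

The lattice property rests on $|u|\in\widetilde{\mathcal W}$ for $u\in\widetilde{\mathcal W}$
(`memWTilde_abs`), which needs convergence of absolute values and not just the inequality
$\rho(|u|)\le\rho(u)$. -/

noncomputable section

namespace FracSobolev

/-! ### Reflexivity of uniformly convex Banach spaces -/

section Reflexivity

open Metric NormedSpace

variable {X : Type*} [NormedAddCommGroup X] [NormedSpace ℝ X]

/-- Two functionals and an element of the unit ball of the bidual: the latter is approximated on
the former by elements of the unit ball. -/
theorem exists_approx_bidual (φ : StrongDual ℝ (StrongDual ℝ X)) (hφ : ‖φ‖ ≤ 1)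
    (f g : StrongDual ℝ X) {ε : ℝ} (hε : 0 < ε) :
    ∃ x : X, ‖x‖ ≤ 1 ∧ |f x - φ f| < ε ∧ |g x - φ g| < ε := by
  set F : X →L[ℝ] ℝ × ℝ := f.prod g
  have hconv : Convex ℝ (closure (F '' closedBall (0 : X) 1)) :=
    ((convex_closedBall (0 : X) 1).is_linear_image F.toLinearMap.isLinear).closure
  have hmem : (φ f, φ g) ∈ closure (F '' closedBall (0 : X) 1) := by
    -- Otherwise some `k` on ℝ² separates the point from the image of the ball. The corresponding
    -- combination `h` of `f` and `g` satisfies `‖h‖ ≤ u < φ h`, against `‖φ‖ ≤ 1`.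
    by_contra hc
    obtain ⟨k, u, hk, hu⟩ := geometric_hahn_banach_closed_point hconv isClosed_closure hc
    have hkF : ∀ a b : ℝ, k (a, b) = a * k (1, 0) + b * k (0, 1) := fun a b => by
      have : ((a, b) : ℝ × ℝ) = a • (1, 0) + b • (0, 1) := by simp
      rw [this, map_add, map_smul, map_smul, smul_eq_mul, smul_eq_mul]
    set h : StrongDual ℝ X := k (1, 0) • f + k (0, 1) • g
    have hφh : φ h = k (φ f, φ g) := by
      rw [hkF, map_add, map_smul, map_smul, smul_eq_mul, smul_eq_mul]; ring
    have hx : ∀ x : X, ‖x‖ ≤ 1 → h x ≤ u := fun x hx => by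
      have := hk (F x) (subset_closure ⟨x, by simpa using hx, rfl⟩)
      have h2 : k (F x) = h x := by
        change k (f x, g x) = _
        rw [hkF]; simp [h]; ring
      linarith
    have hu0 : 0 ≤ u := by simpa using hx 0 (by simp)
    have hn : ‖h‖ ≤ u := by
      refine ContinuousLinearMap.opNorm_le_of_unit_norm hu0 fun x hx1 => ?_
      rw [Real.norm_eq_abs, abs_le]
      have := hx (-x) (by simp [hx1])
      rw [map_neg] at this
      exact ⟨by linarith, hx x hx1.le⟩
    have h3 : φ h ≤ 1 * ‖h‖ := (le_abs_self _).trans ((φ.le_opNorm h).trans (by gcongr))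
    linarith
  obtain ⟨_, ⟨x, hx, rfl⟩, hd⟩ := Metric.mem_closure_iff.1 hmem ε hε
  rw [Prod.dist_eq, max_lt_iff, Real.dist_eq, Real.dist_eq, abs_sub_comm, abs_sub_comm (φ g)] at hd
  exact ⟨x, by simpa using hx, hd⟩

/-- A linear isometry of a Banach space is onto if it approximates all vectors of norm `1`. -/
theorem surjective_of_approx {Z : Type*} [NormedAddCommGroup Z] [NormedSpace ℝ Z] [CompleteSpace X]
    (J : X →ₗᵢ[ℝ] Z) (h : ∀ φ : Z, ‖φ‖ = 1 → ∀ ε > 0, ∃ x, ‖φ - J x‖ < ε) :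
    Function.Surjective J := by
  have hcl : IsClosed (range J) := J.isometry.isClosedEmbedding.isClosed_range
  have key : ∀ φ : Z, ‖φ‖ = 1 → φ ∈ range J := by
    intro φ hφ
    rw [← hcl.closure_eq]
    refine Metric.mem_closure_iff.2 fun ε hε => ?_
    obtain ⟨x, hx⟩ := h φ hφ ε hε
    exact ⟨_, ⟨x, rfl⟩, by rwa [dist_eq_norm]⟩
  intro φ
  rcases eq_or_ne φ 0 with rfl | h0
  · exact ⟨0, map_zero _⟩
  · obtain ⟨x, hx⟩ := key (‖φ‖⁻¹ • φ) (by
      rw [norm_smul, norm_inv, norm_norm, inv_mul_cancel₀ (norm_ne_zero_iff.2 h0)])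
    refine ⟨‖φ‖ • x, ?_⟩
    rw [map_smul, hx, smul_smul, mul_inv_cancel₀ (norm_ne_zero_iff.2 h0), one_smul]

/-- **Milman–Pettis**: a uniformly convex Banach space is reflexive. -/
theorem surjective_inclusionInDoubleDual_of_uniformConvex [CompleteSpace X]
    [UniformConvexSpace X] : Function.Surjective (inclusionInDoubleDual ℝ X) := by
  refine surjective_of_approx (Z := StrongDual ℝ (StrongDual ℝ X)) (inclusionInDoubleDualLi ℝ) fun φ hφ ε hε => ?_
  obtain ⟨δ, hδ, hx⟩ := exists_forall_closed_ball_dist_add_le_two_sub X (half_pos hε)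
  obtain ⟨f, hf1, hf⟩ : ∃ f : StrongDual ℝ X, ‖f‖ ≤ 1 ∧ 1 - δ / 4 < φ f := by
    by_contra! hcon
    have h1 : ‖φ‖ ≤ max (1 - δ / 4) 0 := by
      refine ContinuousLinearMap.opNorm_le_of_unit_norm (le_max_right _ _) fun f hf => ?_
      refine le_trans ?_ (le_max_left _ _)
      rw [Real.norm_eq_abs, abs_le]
      have := hcon (-f) (by simp [hf])
      rw [map_neg] at this
      exact ⟨by linarith, hcon f hf.le⟩
    rw [hφ] at h1
    rcases le_max_iff.1 h1 with h | h <;> linarith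
  -- The slice of the unit ball on which `f` exceeds `1 - δ / 2` has small diameter: for two of its
  -- points the norm of the sum exceeds `2 - δ`.
  have hpair : ∀ x y : X, ‖x‖ ≤ 1 → ‖y‖ ≤ 1 → 1 - δ / 2 < f x → 1 - δ / 2 < f y →
      ‖x - y‖ < ε / 2 := by
    intro x y h1 h2 h3 h4
    by_contra! h
    have h5 := hx h1 h2 h
    have h6 : f (x + y) ≤ 1 * ‖x + y‖ :=
      (le_abs_self _).trans ((f.le_opNorm _).trans (by gcongr))
    rw [map_add] at h6
    linarith
  obtain ⟨x₀, hx₀, hfx₀, -⟩ := exists_approx_bidual φ hφ.le f f (ε := δ / 4) (by positivity)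
  refine ⟨x₀, ?_⟩
  refine lt_of_le_of_lt (b := ε / 2) ?_ (by linarith)
  refine ContinuousLinearMap.opNorm_le_of_unit_norm (by positivity) fun g hg => ?_
  refine le_of_forall_pos_le_add fun η hη => ?_
  -- The point `y` depends on `g`, but it lies in the same slice as `x₀`, so replacing `y` by `x₀`
  -- costs at most `ε / 2` whatever `g` is.
  obtain ⟨y, hy, hfy, hgy⟩ := exists_approx_bidual φ hφ.le f g (ε := min (δ / 4) η) (by positivity)
  have hxy := hpair x₀ y hx₀ hy (by linarith [(abs_lt.1 hfx₀).1])
    (by linarith [(abs_lt.1 (hfy.trans_le (min_le_left _ _))).1])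
  have h7 : |g y - g x₀| ≤ ε / 2 := by
    rw [← map_sub, ← Real.norm_eq_abs]
    calc _ ≤ ‖g‖ * ‖y - x₀‖ := g.le_opNorm _
      _ ≤ ε / 2 := by rw [hg, one_mul, norm_sub_rev]; exact hxy.le
  have h8 := hgy.trans_le (min_le_right _ _)
  change |φ g - g x₀| ≤ _
  calc |φ g - g x₀| = |(g y - g x₀) - (g y - φ g)| := by ring_nf
    _ ≤ _ := (abs_sub _ _).trans (by linarith)

/-- Completeness, separability and reflexivity are invariant under isomorphisms. -/
theorem separableReflexive_of_equiv {Y : Type*} [NormedAddCommGroup Y] [NormedSpace ℝ Y]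
    (e : X ≃L[ℝ] Y) (h : CompleteSpace X ∧ TopologicalSpace.SeparableSpace X ∧
      Function.Surjective (inclusionInDoubleDual ℝ X)) :
    CompleteSpace Y ∧ TopologicalSpace.SeparableSpace Y ∧
      Function.Surjective (inclusionInDoubleDual ℝ Y) := by
  obtain ⟨h1, h2, h3⟩ := h
  refine ⟨(completeSpace_congr (e := e.toEquiv) e.isUniformEmbedding).1 h1,
    e.surjective.denseRange.separableSpace e.continuous, fun φ => ?_⟩
  let T : StrongDual ℝ X →L[ℝ] StrongDual ℝ Y :=
    ContinuousLinearMap.precomp ℝ (e.symm : Y →L[ℝ] X)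
  obtain ⟨x, hx⟩ := h3 (φ.comp T)
  refine ⟨e x, ?_⟩
  ext g
  have := congrArg (fun ψ => ψ (g.comp (e : X →L[ℝ] Y))) hx
  simp only [dual_def, ContinuousLinearMap.comp_apply] at this
  rw [dual_def]
  refine this.trans ?_
  congr 1
  ext y
  simp [T]

end Reflexivity

/-! ### Convex modulars and their Luxembourg norms -/

section Modular

open Filter Topology

variable {V : Type*} [AddCommGroup V] [Module ℝ V]

/-- `ρ` is, on the subspace `M`, a convex modular of power growth at most `b` that is uniformly
convex, in the sense that the deviation from midpoint convexity controls the distance. -/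
structure IsModularOn (M : Submodule ℝ V) (ρ : V → ℝ≥0∞) (b : ℝ) : Prop where
  pos : 0 < b
  map_zero : ρ 0 = 0
  map_neg : ∀ u, ρ (-u) = ρ u
  convex : ∀ u ∈ M, ∀ v ∈ M, ∀ s t : ℝ, 0 ≤ s → 0 ≤ t → s + t = 1 →
    ρ (s • u + t • v) ≤ ENNReal.ofReal s * ρ u + ENNReal.ofReal t * ρ v
  growth : ∀ u ∈ M, ∀ c : ℝ, 1 ≤ c → ρ (c • u) ≤ ENNReal.ofReal (c ^ b) * ρ u
  uniform : ∀ θ : ℝ, 0 < θ → ∃ K₀ : ℝ, 0 < K₀ ∧ ∀ K : ℝ, K₀ ≤ K → ∀ u ∈ M, ∀ v ∈ M,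
    ρ (u - v) + ENNReal.ofReal K * ρ ((1 / 2 : ℝ) • (u + v)) ≤
      ENNReal.ofReal (θ + K / 2) * (ρ u + ρ v)

/-- The Luxembourg norm of a modular. -/
def lux (ρ : V → ℝ≥0∞) (u : V) : ℝ := sInf {t : ℝ | 0 < t ∧ ρ (t⁻¹ • u) ≤ 1}

theorem lux_nonneg (ρ : V → ℝ≥0∞) (u : V) : 0 ≤ lux ρ u :=
  Real.sInf_nonneg fun _ ht => ht.1.le

theorem lux_le {ρ : V → ℝ≥0∞} {u : V} {t : ℝ} (ht : 0 < t) (h : ρ (t⁻¹ • u) ≤ 1) :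
    lux ρ u ≤ t :=
  csInf_le ⟨0, fun _ hx => hx.1.le⟩ ⟨ht, h⟩

namespace IsModularOn

variable {M : Submodule ℝ V} {ρ σ : V → ℝ≥0∞} {b : ℝ} (h : IsModularOn M ρ b)
include h

theorem add (h' : IsModularOn M σ b) : IsModularOn M (fun u => ρ u + σ u) b where
  pos := h.pos
  map_zero := by rw [h.map_zero, h'.map_zero, add_zero]
  map_neg u := by rw [h.map_neg, h'.map_neg]
  convex u hu v hv s t hs ht hst := by
    refine (add_le_add (h.convex u hu v hv s t hs ht hst)
      (h'.convex u hu v hv s t hs ht hst)).trans_eq (by ring)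
  growth u hu c hc := (add_le_add (h.growth u hu c hc) (h'.growth u hu c hc)).trans_eq (by ring)
  uniform θ hθ := by
    obtain ⟨K₁, h1, hK₁⟩ := h.uniform θ hθ
    obtain ⟨K₂, h2, hK₂⟩ := h'.uniform θ hθ
    -- Since the inequality holds for all large `K`, one common `K` serves both modulars.
    refine ⟨max K₁ K₂, lt_max_of_lt_left h1, fun K hK u hu v hv => ?_⟩
    refine le_trans (le_of_eq ?_) ((add_le_add (hK₁ K ((le_max_left _ _).trans hK) u hu v hv)
      (hK₂ K ((le_max_right _ _).trans hK) u hu v hv)).trans_eq ?_) <;> ring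

theorem smul_le {u : V} (hu : u ∈ M) {c : ℝ} (h0 : 0 ≤ c) (h1 : c ≤ 1) :
    ρ (c • u) ≤ ENNReal.ofReal c * ρ u := by
  simpa [h.map_zero] using h.convex u hu 0 M.zero_mem c (1 - c) h0 (by linarith) (by ring)

theorem map_abs_smul (c : ℝ) (u : V) : ρ (|c| • u) = ρ (c • u) := by
  rcases abs_choice c with hc | hc <;> rw [hc]
  rw [neg_smul, h.map_neg]

theorem smul_lt_top {u : V} (hu : u ∈ M) (hf : ρ u < ∞) (c : ℝ) : ρ (c • u) < ∞ := by
  rw [← h.map_abs_smul]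
  rcases le_total |c| 1 with hc | hc
  · exact (h.smul_le hu (abs_nonneg c) hc).trans_lt (ENNReal.mul_lt_top ENNReal.ofReal_lt_top hf)
  · exact (h.growth u hu _ hc).trans_lt (ENNReal.mul_lt_top ENNReal.ofReal_lt_top hf)

/-- The space of the vectors of finite modular. -/
def dom : Submodule ℝ V where
  carrier := {u | u ∈ M ∧ ρ u < ∞}
  zero_mem' := ⟨M.zero_mem, by simp [h.map_zero]⟩
  smul_mem' c u hu := ⟨M.smul_mem c hu.1, h.smul_lt_top hu.1 hu.2 c⟩
  add_mem' := by
    rintro u v ⟨hu, hu'⟩ ⟨hv, hv'⟩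
    refine ⟨M.add_mem hu hv, ?_⟩
    have := h.convex _ (M.smul_mem 2 hu) _ (M.smul_mem 2 hv) (1 / 2) (1 / 2)
      (by norm_num) (by norm_num) (by norm_num)
    rw [smul_smul, smul_smul] at this
    norm_num at this
    refine this.trans_lt (ENNReal.add_lt_top.2 ⟨?_, ?_⟩)
    · exact ENNReal.mul_lt_top (by simp) (h.smul_lt_top hu hu' 2)
    · exact ENNReal.mul_lt_top (by simp) (h.smul_lt_top hv hv' 2)

theorem lux_set_nonempty {u : V} (hu : u ∈ h.dom) :
    {t : ℝ | 0 < t ∧ ρ (t⁻¹ • u) ≤ 1}.Nonempty := by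
  have ht : (1 : ℝ) ≤ max 1 (ρ u).toReal := le_max_left _ _
  have h0 : (0 : ℝ) < max 1 (ρ u).toReal := by linarith
  refine ⟨max 1 (ρ u).toReal, h0, ?_⟩
  refine (h.smul_le hu.1 (by positivity) (inv_le_one_of_one_le₀ ht)).trans ?_
  rw [← ENNReal.ofReal_toReal hu.2.ne, ← ENNReal.ofReal_mul (by positivity), ENNReal.ofReal_le_one,
    ENNReal.ofReal_toReal hu.2.ne, inv_mul_le_iff₀ h0, mul_one]
  exact le_max_right _ _

theorem le_one_of_lux_lt {u : V} (hu : u ∈ h.dom) {t : ℝ} (ht : lux ρ u < t) :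
    ρ (t⁻¹ • u) ≤ 1 := by
  obtain ⟨t', ⟨h0, h1⟩, hlt⟩ := exists_lt_of_csInf_lt (h.lux_set_nonempty hu) ht
  have htp : 0 < t := h0.trans hlt
  have : t⁻¹ • u = (t' / t) • t'⁻¹ • u := by
    rw [smul_smul]; congr 1; field_simp
  rw [this]
  refine (h.smul_le (M.smul_mem _ hu.1) (by positivity) ((div_le_one htp).2 hlt.le)).trans ?_
  refine mul_le_one' ?_ h1
  rw [ENNReal.ofReal_le_one]
  exact (div_le_one htp).2 hlt.le

/-- The infimum is attained: the growth bound gives `ρ (t⁻¹ • u) ≤ c ^ b` for every `c > 1`, and `c`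
tends to `1`. No semicontinuity of `ρ` is needed. -/
theorem lux_le_iff {u : V} (hu : u ∈ h.dom) {t : ℝ} (ht : 0 < t) :
    lux ρ u ≤ t ↔ ρ (t⁻¹ • u) ≤ 1 := by
  refine ⟨fun hl => ?_, lux_le ht⟩
  have hc : ∀ c : ℝ, 1 < c → ρ (t⁻¹ • u) ≤ ENNReal.ofReal (c ^ b) := by
    intro c hc
    have h0 : 0 < c := by linarith
    have h1 := h.le_one_of_lux_lt hu (hl.trans_lt ((lt_mul_iff_one_lt_left ht).2 hc))
    have : t⁻¹ • u = c • (c * t)⁻¹ • u := by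
      rw [smul_smul]; congr 1; field_simp
    rw [this]
    refine (h.growth _ (M.smul_mem _ hu.1) c hc.le).trans ?_
    exact (mul_le_mul_right h1 _).trans_eq (mul_one _)
  have hlim : Tendsto (fun c : ℝ => ENNReal.ofReal (c ^ b)) (𝓝[>] 1) (𝓝 (ENNReal.ofReal (1 ^ b))) :=
    (ENNReal.continuous_ofReal.tendsto _).comp
      ((Real.continuousAt_rpow_const 1 b (Or.inl one_ne_zero)).tendsto.mono_left
        nhdsWithin_le_nhds)
  rw [Real.one_rpow, ENNReal.ofReal_one] at hlim
  exact ge_of_tendsto hlim (eventually_mem_nhdsWithin.mono fun c hc' => hc c hc')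

theorem lux_zero : lux ρ 0 = 0 :=
  le_antisymm (le_of_forall_pos_le_add fun ε hε => by
    rw [zero_add]; exact lux_le hε (by simp [h.map_zero])) (lux_nonneg _ _)

theorem lux_mono {τ : V → ℝ≥0∞} {u v : V} (hv : v ∈ h.dom)
    (hle : ∀ c : ℝ, 0 < c → τ (c • u) ≤ ρ (c • v)) : lux τ u ≤ lux ρ v :=
  csInf_le_csInf ⟨0, fun _ hx => hx.1.le⟩ (h.lux_set_nonempty hv)
    fun _ ht => ⟨ht.1, (hle _ (inv_pos.2 ht.1)).trans ht.2⟩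

theorem lux_smul {u : V} (hu : u ∈ h.dom) (c : ℝ) : lux ρ (c • u) = |c| * lux ρ u := by
  have key : ∀ (c : ℝ) (u : V), u ∈ h.dom → c ≠ 0 → lux ρ (c • u) ≤ |c| * lux ρ u := by
    intro c u hu hc
    have hc' : 0 < |c| := abs_pos.2 hc
    rw [← div_le_iff₀' hc']
    refine le_of_forall_gt_imp_ge_of_dense fun t ht => ?_
    have htp : 0 < t := (lux_nonneg ρ u).trans_lt ht
    rw [div_le_iff₀' hc']
    refine lux_le (by positivity) ?_
    have : ρ ((|c| * t)⁻¹ • c • u) = ρ (t⁻¹ • u) := by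
      rw [smul_smul, ← h.map_abs_smul ((|c| * t)⁻¹ * c), abs_mul, abs_inv, abs_mul, abs_abs,
        abs_of_pos htp]
      congr 2; field_simp
    rw [this]
    exact h.le_one_of_lux_lt hu ht
  rcases eq_or_ne c 0 with rfl | hc
  · simp [h.lux_zero]
  refine le_antisymm (key c u hu hc) ?_
  have h2 := key c⁻¹ (c • u) (h.dom.smul_mem c hu) (inv_ne_zero hc)
  rwa [smul_smul, inv_mul_cancel₀ hc, one_smul, abs_inv, le_inv_mul_iff₀ (abs_pos.2 hc)] at h2

theorem lux_neg (u : V) : lux ρ (-u) = lux ρ u := by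
  simp only [lux, smul_neg, h.map_neg]

theorem lux_sub_comm (u v : V) : lux ρ (u - v) = lux ρ (v - u) := by
  rw [← h.lux_neg, neg_sub]

theorem lux_add_le {u v : V} (hu : u ∈ h.dom) (hv : v ∈ h.dom) :
    lux ρ (u + v) ≤ lux ρ u + lux ρ v := by
  refine le_of_forall_pos_le_add fun ε hε => ?_
  set s := lux ρ u + ε / 2 with hs
  set t := lux ρ v + ε / 2 with ht
  have hsp : 0 < s := by have := lux_nonneg ρ u; positivity
  have htp : 0 < t := by have := lux_nonneg ρ v; positivity
  have h1 := h.le_one_of_lux_lt hu (t := s) (by linarith)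
  have h2 := h.le_one_of_lux_lt hv (t := t) (by linarith)
  have hst : lux ρ u + lux ρ v + ε = s + t := by rw [hs, ht]; ring
  rw [hst]
  refine lux_le (by positivity) ?_
  have h3 := h.convex _ (M.smul_mem s⁻¹ hu.1) _ (M.smul_mem t⁻¹ hv.1) (s / (s + t)) (t / (s + t))
    (by positivity) (by positivity) (by field_simp)
  have h4 : (s + t)⁻¹ • (u + v) = (s / (s + t)) • s⁻¹ • u + (t / (s + t)) • t⁻¹ • v := by
    rw [smul_smul, smul_smul, smul_add]
    congr 2 <;> field_simp
  rw [h4]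
  refine h3.trans ((add_le_add (mul_le_mul_right h1 _) (mul_le_mul_right h2 _)).trans ?_)
  rw [mul_one, mul_one, ← ENNReal.ofReal_add (by positivity) (by positivity), ← add_div,
    div_self (by positivity), ENNReal.ofReal_one]

theorem lux_sub_le {u v w : V} (hu : u ∈ h.dom) (hv : v ∈ h.dom) (hw : w ∈ h.dom) :
    lux ρ (u - w) ≤ lux ρ (u - v) + lux ρ (v - w) := by
  simpa using h.lux_add_le (h.dom.sub_mem hu hv) (h.dom.sub_mem hv hw)

theorem le_of_lux_le {u : V} (hu : u ∈ h.dom) {t : ℝ} (h0 : 0 < t) (h1 : t ≤ 1)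
    (hl : lux ρ u ≤ t) : ρ u ≤ ENNReal.ofReal t := by
  have h2 := (h.lux_le_iff hu h0).1 hl
  have h3 := h.smul_le (M.smul_mem t⁻¹ hu.1) h0.le h1
  rw [smul_smul, mul_inv_cancel₀ h0.ne', one_smul] at h3
  exact h3.trans ((mul_le_mul_right h2 _).trans_eq (mul_one _))

/-- Enlarging `u` by the factor `t⁻¹ ≥ 1` multiplies the modular by at most `t ^ (-b)`, hence the
threshold `t ^ b`. Together with `le_of_lux_le` this makes smallness in norm and in modular
interchangeable. -/
theorem lux_le_of_le {u : V} (hu : u ∈ M) {t : ℝ} (h0 : 0 < t) (h1 : t ≤ 1)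
    (hl : ρ u ≤ ENNReal.ofReal (t ^ b)) : lux ρ u ≤ t := by
  refine lux_le h0 ((h.growth u hu _ ((one_le_inv₀ h0).2 h1)).trans
    ((mul_le_mul_right hl _).trans_eq ?_))
  rw [← ENNReal.ofReal_mul (by positivity), ← Real.mul_rpow (by positivity) h0.le,
    inv_mul_cancel₀ h0.ne', Real.one_rpow, ENNReal.ofReal_one]

theorem eq_zero_of_lux_eq_zero {u : V} (hu : u ∈ h.dom) (hl : lux ρ u = 0) : ρ u = 0 := by
  by_contra h0
  obtain ⟨t, ht0, ht⟩ := ENNReal.lt_iff_exists_nnreal_btwn.1 (pos_iff_ne_zero.2 h0)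
  have ht0' : (0 : ℝ) < t := by exact_mod_cast ht0
  have h1 := h.le_of_lux_le hu (t := min t 1) (by positivity) (min_le_right _ _)
    (by rw [hl]; positivity)
  refine absurd (ht.trans_le (h1.trans (ENNReal.ofReal_le_ofReal (min_le_left _ _)))) ?_
  simp

/-- If `s` and `t` exceed the two norms, convexity bounds the modulars of `u` divided by `s + t` by
`s / (s + t)` and `t / (s + t)`, which add up to `1`. This is the source of the constant 1 in
$\|u\|_\rho\le\|u\|$. -/
theorem lux_add_modular_le (h' : IsModularOn M σ b) {u : V} (hu : u ∈ (h.add h').dom) :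
    lux (fun u => ρ u + σ u) u ≤ lux ρ u + lux σ u := by
  have hu1 : u ∈ h.dom := ⟨hu.1, lt_of_le_of_lt le_self_add hu.2⟩
  have hu2 : u ∈ h'.dom := ⟨hu.1, lt_of_le_of_lt le_add_self hu.2⟩
  refine le_of_forall_pos_le_add fun ε hε => ?_
  set s := lux ρ u + ε / 2 with hs
  set t := lux σ u + ε / 2 with ht
  have hsp : 0 < s := by have := lux_nonneg ρ u; positivity
  have htp : 0 < t := by have := lux_nonneg σ u; positivity
  have h1 := h.le_one_of_lux_lt hu1 (t := s) (by linarith)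
  have h2 := h'.le_one_of_lux_lt hu2 (t := t) (by linarith)
  have hst : lux ρ u + lux σ u + ε = s + t := by rw [hs, ht]; ring
  rw [hst]
  refine lux_le (by positivity) ?_
  have e1 : (s + t)⁻¹ • u = (s / (s + t)) • s⁻¹ • u := by
    rw [smul_smul]; congr 1; field_simp
  have e2 : (s + t)⁻¹ • u = (t / (s + t)) • t⁻¹ • u := by
    rw [smul_smul]; congr 1; field_simp
  have h3 : ρ ((s + t)⁻¹ • u) ≤ ENNReal.ofReal (s / (s + t)) := by
    rw [e1]
    refine (h.smul_le (M.smul_mem _ hu.1) (by positivity) ?_).trans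
      ((mul_le_mul_right h1 _).trans_eq (mul_one _))
    rw [div_le_one (by positivity)]; linarith
  have h4 : σ ((s + t)⁻¹ • u) ≤ ENNReal.ofReal (t / (s + t)) := by
    rw [e2]
    refine (h'.smul_le (M.smul_mem _ hu.1) (by positivity) ?_).trans
      ((mul_le_mul_right h2 _).trans_eq (mul_one _))
    rw [div_le_one (by positivity)]; linarith
  refine (add_le_add h3 h4).trans ?_
  rw [← ENNReal.ofReal_add (by positivity) (by positivity), ← add_div,
    div_self (by positivity), ENNReal.ofReal_one]

/-- The Luxembourg norm of a uniformly convex modular is uniformly convex. -/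
theorem lux_uniformConvex {ε : ℝ} (hε : 0 < ε) : ∃ δ : ℝ, 0 < δ ∧ ∀ u ∈ h.dom, ∀ v ∈ h.dom,
    lux ρ u ≤ 1 → lux ρ v ≤ 1 → ε ≤ lux ρ (u - v) → lux ρ (u + v) ≤ 2 - δ := by
  -- Taking `e` strictly below `ε` and at most `1` turns `ε ≤ lux ρ (u - v)` into the modular bound
  -- `ρ (u - v) > e ^ b`.
  have hb := h.pos
  set e := min ε 1 / 2 with he
  have he0 : 0 < e := by positivity
  have he1 : e < ε := by
    have := min_le_left ε 1
    linarith
  have he2 : e ≤ 1 := by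
    have := min_le_right ε 1
    linarith
  set η := e ^ b with hη
  have hη0 : 0 < η := by positivity
  obtain ⟨K₀, hK₀, hK⟩ := h.uniform (η / 4) (by positivity)
  -- With `θ = η / 4` and both modulars at most `1`, the inequality reads `η + K ρ(midpoint) ≤ η / 2
  -- + K`, so the modular of the midpoint is at most `m = 1 - η / (2 K)`. The condition `η ≤ K`
  -- keeps `m` positive; the norm of the midpoint is then at most `m ^ b⁻¹`.
  set K := max K₀ η
  have hKη : η ≤ K := le_max_right _ _
  have hKp : 0 < K := hη0.trans_le hKη
  set m := 1 - η / (2 * K) with hm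
  have hm1 : m < 1 := by
    have : 0 < η / (2 * K) := by positivity
    linarith
  have hm0 : 0 < m := by
    have : η / (2 * K) < 1 := by rw [div_lt_one (by positivity)]; linarith
    linarith
  have ht1 : m ^ b⁻¹ < 1 := Real.rpow_lt_one hm0.le hm1 (by positivity)
  refine ⟨2 - 2 * m ^ b⁻¹, by linarith, fun u hu v hv hu1 hv1 huv => ?_⟩
  have hρu := (h.lux_le_iff hu one_pos).1 hu1
  have hρv := (h.lux_le_iff hv one_pos).1 hv1
  rw [inv_one, one_smul] at hρu hρv
  have hd : ENNReal.ofReal η < ρ (u - v) := by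
    by_contra! hc
    linarith [h.lux_le_of_le (M.sub_mem hu.1 hv.1) he0 he2 hc]
  have hmid : ρ ((1 / 2 : ℝ) • (u + v)) ≤ ENNReal.ofReal m := by
    have h1 := (add_le_add_left hd.le _).trans (hK K (le_max_left _ _) u hu.1 v hv.1)
    have h2 := h1.trans (mul_le_mul_right (add_le_add hρu hρv) _)
    have hfin := ((h.dom.smul_mem (1 / 2 : ℝ) (h.dom.add_mem hu hv)).2).ne
    rw [← ENNReal.ofReal_toReal hfin] at h2 ⊢
    have h22 : (1 : ℝ≥0∞) + 1 = ENNReal.ofReal 2 := by norm_num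
    rw [← ENNReal.ofReal_mul hKp.le, ← ENNReal.ofReal_add hη0.le (by positivity), h22,
      ← ENNReal.ofReal_mul (by positivity), ENNReal.ofReal_le_ofReal_iff (by positivity)] at h2
    refine ENNReal.ofReal_le_ofReal ?_
    rw [hm, le_sub_iff_add_le, ← le_sub_iff_add_le', div_le_iff₀ (by positivity)]
    nlinarith
  have h5 := h.lux_le_of_le (M.smul_mem (1 / 2 : ℝ) (M.add_mem hu.1 hv.1))
    (t := m ^ b⁻¹) (by positivity) ht1.le
    (by rwa [← Real.rpow_mul hm0.le, inv_mul_cancel₀ hb.ne', Real.rpow_one])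
  rw [h.lux_smul (h.dom.add_mem hu hv), abs_of_pos (by norm_num)] at h5
  linarith

end IsModularOn

end Modular

/-! ### Inequalities for powers of real numbers -/

section Pointwise

/-- If the absolute values differ, the power is strictly convex on the half-line. If they agree,
then `x = -y ≠ 0` and the midpoint is `0`. -/
theorem abs_midpoint_rpow_lt {r x y : ℝ} (hr : 1 < r) (hxy : x ≠ y) :
    |(x + y) / 2| ^ r < (|x| ^ r + |y| ^ r) / 2 := by
  have hr0 : 0 < r := by linarith
  have habs : |(x + y) / 2| ≤ (|x| + |y|) / 2 := by
    rw [abs_div, abs_two]; gcongr; exact abs_add_le x y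
  rcases eq_or_ne |x| |y| with he | he
  · rcases abs_eq_abs.1 he with h | h
    · exact absurd h hxy
    · have hy : y ≠ 0 := by rintro rfl; simp at h; exact hxy h
      have hy' := abs_pos.2 hy
      rw [h, neg_add_cancel, zero_div, abs_zero, Real.zero_rpow hr0.ne', abs_neg]
      positivity
  · refine (Real.rpow_le_rpow (abs_nonneg _) habs hr0.le).trans_lt ?_
    have := (strictConvexOn_rpow hr).2 (abs_nonneg x) (abs_nonneg y) he
      (show (0 : ℝ) < 1 / 2 by norm_num) (show (0 : ℝ) < 1 / 2 by norm_num) (by norm_num)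
    simp only [smul_eq_mul] at this
    convert this using 1 <;> ring_nf

theorem abs_midpoint_rpow_le {r : ℝ} (hr : 1 < r) (x y : ℝ) :
    |(x + y) / 2| ^ r ≤ (|x| ^ r + |y| ^ r) / 2 := by
  rcases eq_or_ne x y with rfl | h
  · simp
  · exact (abs_midpoint_rpow_lt hr h).le

theorem abs_convex_rpow_le {r : ℝ} (hr : 1 ≤ r) (x y : ℝ) {s t : ℝ} (hs : 0 ≤ s) (ht : 0 ≤ t)
    (hst : s + t = 1) : |s * x + t * y| ^ r ≤ s * |x| ^ r + t * |y| ^ r := by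
  have habs : |s * x + t * y| ≤ s * |x| + t * |y| :=
    (abs_add_le _ _).trans (by rw [abs_mul, abs_mul, abs_of_nonneg hs, abs_of_nonneg ht])
  exact (Real.rpow_le_rpow (abs_nonneg _) habs (by linarith)).trans
    ((convexOn_rpow hr).2 (abs_nonneg x) (abs_nonneg y) hs ht hst)

theorem abs_add_rpow_le {r b : ℝ} (hr : 1 ≤ r) (hrb : r ≤ b) (x y : ℝ) :
    |x + y| ^ r ≤ 2 ^ b * (|x| ^ r + |y| ^ r) := by
  have h1 := abs_convex_rpow_le hr (2 * x) (2 * y) (s := 1 / 2) (t := 1 / 2) (by norm_num)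
    (by norm_num) (by norm_num)
  have h2 : (2 : ℝ) ^ r ≤ 2 ^ b := Real.rpow_le_rpow_of_exponent_le one_le_two hrb
  rw [abs_mul, abs_mul, abs_two, Real.mul_rpow two_pos.le (abs_nonneg _),
    Real.mul_rpow two_pos.le (abs_nonneg _)] at h1
  have h3 : 1 / 2 * (2 * x) + 1 / 2 * (2 * y) = x + y := by ring
  rw [h3] at h1
  have hx : 0 ≤ |x| ^ r := by positivity
  have hy : 0 ≤ |y| ^ r := by positivity
  have h4 : (0 : ℝ) < 2 ^ r := by positivity
  nlinarith [mul_le_mul_of_nonneg_right h2 (add_nonneg hx hy), mul_nonneg h4.le (add_nonneg hx hy)]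

/-- Uniform convexity of the powers with exponents in a compact subinterval of `(1, ∞)`. -/
theorem abs_rpow_uniformConvex {a b : ℝ} (ha : 1 < a) {θ : ℝ} (hθ : 0 < θ) :
    ∃ K₀ : ℝ, 0 < K₀ ∧ ∀ K, K₀ ≤ K → ∀ r, a ≤ r → r ≤ b → ∀ x y : ℝ,
      |x - y| ^ r + K * |(x + y) / 2| ^ r ≤ (θ + K / 2) * (|x| ^ r + |y| ^ r) := by
  have ha0 : 0 < a := by linarith
  -- Replacing `r` by `max r a` keeps the exponent positive, so that `g` is jointly continuous
  -- everywhere; nothing changes for `r ≥ a`.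
  set g : ℝ → ℝ → ℝ := fun r x => |x| ^ max r a with hg
  have hgc : ∀ {f : ℝ × ℝ × ℝ → ℝ}, Continuous f → Continuous fun z => g z.1 (f z) := by
    intro f hf
    refine continuous_iff_continuousAt.2 fun z => ?_
    exact ContinuousAt.rpow hf.abs.continuousAt
      (continuous_fst.max continuous_const).continuousAt (Or.inr (lt_max_of_lt_right ha0))
  -- `A` collects the normalized pairs that are too far apart for the term with `θ` to absorb `|x -
  -- y| ^ r`. Such pairs have `x ≠ y`, so the convexity defect `J` is positive on `A` and, by
  -- compactness, bounded below by some `m > 0`.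
  set A : Set (ℝ × ℝ × ℝ) := (Icc a b ×ˢ Icc (-1) 1 ×ˢ Icc (-1) 1) ∩
    {z | max |z.2.1| |z.2.2| = 1 ∧
      θ * (g z.1 z.2.1 + g z.1 z.2.2) ≤ g z.1 (z.2.1 - z.2.2)} with hA
  have hAc : IsCompact A := by
    refine (isCompact_Icc.prod (isCompact_Icc.prod isCompact_Icc)).inter_right ?_
    rw [ofPred_and]
    refine (isClosed_eq (by fun_prop) continuous_const).inter (isClosed_le ?_ ?_)
    · exact continuous_const.mul ((hgc (by fun_prop)).add (hgc (by fun_prop)))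
    · exact hgc (by fun_prop)
  set J : ℝ × ℝ × ℝ → ℝ := fun z => (g z.1 z.2.1 + g z.1 z.2.2) / 2 - g z.1 ((z.2.1 + z.2.2) / 2)
  have hJc : Continuous J :=
    (((hgc (by fun_prop)).add (hgc (by fun_prop))).div_const 2).sub (hgc (by fun_prop))
  have hge : ∀ {r : ℝ}, a ≤ r → ∀ x, g r x = |x| ^ r := fun hr x => by
    simp only [hg, max_eq_left hr]
  have hJpos : ∀ z ∈ A, 0 < J z := by
    rintro ⟨r, x, y⟩ ⟨⟨hr, -⟩, hmax, hz⟩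
    simp only at hmax hz hr
    simp only [J, hge hr.1] at hz ⊢
    have hr1 : 1 < r := ha.trans_le hr.1
    have hxy : x ≠ y := by
      rintro rfl
      rw [max_self] at hmax
      rw [sub_self, abs_zero, Real.zero_rpow (by linarith), hmax, Real.one_rpow] at hz
      linarith
    linarith [abs_midpoint_rpow_lt hr1 hxy]
  obtain ⟨m, hm, hmJ⟩ : ∃ m : ℝ, 0 < m ∧ ∀ z ∈ A, m ≤ J z := by
    rcases A.eq_empty_or_nonempty with he | hne
    · exact ⟨1, one_pos, by simp [he]⟩
    · obtain ⟨z, hz, hmin⟩ := hAc.exists_isMinOn hne hJc.continuousOn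
      exact ⟨J z, hJpos z hz, fun w hw => hmin hw⟩
  -- On `A`, `|x - y| ^ r ≤ 2 ^ b ≤ K * m` is absorbed by `K` times the defect. Off `A`, the term
  -- with `θ` and plain midpoint convexity suffice.
  refine ⟨2 ^ b / m, by positivity, fun K hK r hra hrb x y => ?_⟩
  have hr1 : 1 < r := ha.trans_le hra
  have hr0 : 0 < r := by linarith
  have hK0 : 0 < K := lt_of_lt_of_le (by positivity) hK
  have hunit : ∀ x y : ℝ, max |x| |y| = 1 →
      |x - y| ^ r + K * |(x + y) / 2| ^ r ≤ (θ + K / 2) * (|x| ^ r + |y| ^ r) := by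
    intro x y hxy
    have hx1 : |x| ≤ 1 := hxy ▸ le_max_left _ _
    have hy1 : |y| ≤ 1 := hxy ▸ le_max_right _ _
    have hmid := abs_midpoint_rpow_le hr1 x y
    have hs : 0 ≤ |x| ^ r + |y| ^ r := by positivity
    by_cases hc : θ * (|x| ^ r + |y| ^ r) ≤ |x - y| ^ r
    · have hz : (r, x, y) ∈ A := by
        refine ⟨⟨⟨hra, hrb⟩, abs_le.1 hx1, abs_le.1 hy1⟩, hxy, ?_⟩
        simpa only [hge hra] using hc
      have h1 := hmJ _ hz
      simp only [J, hge hra] at h1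
      have h2 : |x - y| ^ r ≤ 2 ^ b := by
        refine (Real.rpow_le_rpow (abs_nonneg _) ((abs_sub x y).trans
          (by linarith : |x| + |y| ≤ 2)) hr0.le).trans ?_
        exact Real.rpow_le_rpow_of_exponent_le one_le_two hrb
      have h3 : 2 ^ b ≤ K * m := (div_le_iff₀ hm).1 hK
      have h4 := mul_le_mul_of_nonneg_left h1 hK0.le
      have h5 := mul_nonneg hθ.le hs
      linarith
    · push Not at hc
      have := mul_le_mul_of_nonneg_left hmid hK0.le
      linarith
  -- Both sides are homogeneous of degree `r`, which reduces the inequality to normalized pairs.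
  rcases eq_or_ne (max |x| |y|) 0 with h0 | h0
  · have hx : x = 0 := abs_nonpos_iff.1 (h0 ▸ le_max_left _ _)
    have hy : y = 0 := abs_nonpos_iff.1 (h0 ▸ le_max_right _ _)
    subst hx hy
    simp [Real.zero_rpow hr0.ne']
  · set m' := max |x| |y|
    have hm' : 0 < m' := lt_of_le_of_ne ((abs_nonneg x).trans (le_max_left _ _)) h0.symm
    have hsc : ∀ t : ℝ, |m' * t| ^ r = m' ^ r * |t| ^ r := fun t => by
      rw [abs_mul, abs_of_pos hm', Real.mul_rpow hm'.le (abs_nonneg _)]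
    have h1 := hunit (x / m') (y / m') (by
      rw [abs_div, abs_div, abs_of_pos hm']
      exact (max_div_div_right hm'.le _ _).trans (div_self h0))
    have h2 := mul_le_mul_of_nonneg_left h1 (Real.rpow_nonneg hm'.le r)
    have e1 : x - y = m' * (x / m' - y / m') := by field_simp
    have e2 : (x + y) / 2 = m' * ((x / m' + y / m') / 2) := by field_simp
    have e3 : x = m' * (x / m') := by field_simp
    have e4 : y = m' * (y / m') := by field_simp
    rw [e1, e2, hsc, hsc]
    calc _ = m' ^ r * (|x / m' - y / m'| ^ r + K * |(x / m' + y / m') / 2| ^ r) := by ring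
      _ ≤ _ := h2
      _ = (θ + K / 2) * (|m' * (x / m')| ^ r + |m' * (y / m')| ^ r) := by
        rw [hsc, hsc]; ring
      _ = _ := by rw [← e3, ← e4]

/-- The odd power function with exponent `r`. -/
def signedPow (r x : ℝ) : ℝ := x * |x| ^ (r - 1)

/-- For equal signs this is superadditivity of the power on the half-line, with constant `1`. For
opposite signs the right-hand difference is a sum of powers, and convexity costs the factor `2 ^ r`.
-/
theorem abs_sub_rpow_le_signedPow {r : ℝ} (hr : 1 ≤ r) (x y : ℝ) :
    |x - y| ^ r ≤ 2 ^ r * |signedPow r x - signedPow r y| := by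
  have hr0 : 0 < r := by linarith
  have h2 : (1 : ℝ) ≤ 2 ^ r := Real.one_le_rpow one_le_two hr0.le
  have hpos : ∀ x : ℝ, 0 ≤ x → signedPow r x = x ^ r := fun x hx => by
    rcases hx.eq_or_lt with rfl | hx
    · simp [signedPow, Real.zero_rpow hr0.ne']
    · rw [signedPow, abs_of_pos hx, Real.rpow_sub_one hx.ne', mul_div_cancel₀ _ hx.ne']
  have hneg : ∀ x : ℝ, signedPow r (-x) = -signedPow r x := fun x => by
    simp [signedPow]
  have hord : ∀ x y : ℝ, 0 ≤ y → y ≤ x → |x - y| ^ r ≤ 2 ^ r * |signedPow r x - signedPow r y| := by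
    intro x y hy hyx
    rw [hpos x (hy.trans hyx), hpos y hy, abs_of_nonneg (sub_nonneg.2 hyx)]
    have h1 := Real.add_rpow_le_rpow_add (sub_nonneg.2 hyx) hy hr
    rw [sub_add_cancel] at h1
    have h3 : (x - y) ^ r ≤ |x ^ r - y ^ r| := by
      refine le_trans ?_ (le_abs_self _); linarith
    exact h3.trans (le_mul_of_one_le_left (abs_nonneg _) h2)
  have hopp : ∀ x y : ℝ, 0 ≤ x → 0 ≤ y →
      |x - -y| ^ r ≤ 2 ^ r * |signedPow r x - signedPow r (-y)| := by
    intro x y hx hy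
    rw [hneg, hpos x hx, hpos y hy, sub_neg_eq_add, sub_neg_eq_add,
      abs_of_nonneg (show 0 ≤ x ^ r + y ^ r by positivity)]
    simpa [abs_of_nonneg hx, abs_of_nonneg hy] using abs_add_rpow_le hr le_rfl x y
  have hnn : ∀ x y : ℝ, 0 ≤ x → 0 ≤ y → |x - y| ^ r ≤ 2 ^ r * |signedPow r x - signedPow r y| := by
    intro x y hx hy
    rcases le_total y x with h | h
    · exact hord x y hy h
    · rw [abs_sub_comm, abs_sub_comm (signedPow r x)]; exact hord y x hx h
  rcases le_total 0 x with hx | hx <;> rcases le_total 0 y with hy | hy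
  · exact hnn x y hx hy
  · simpa using hopp x (-y) hx (neg_nonneg.2 hy)
  · have := hopp y (-x) hy (neg_nonneg.2 hx)
    rwa [neg_neg, abs_sub_comm, abs_sub_comm (signedPow r y)] at this
  · have := hnn (-x) (-y) (neg_nonneg.2 hx) (neg_nonneg.2 hy)
    rw [hneg, hneg] at this
    rw [abs_sub_comm x y, abs_sub_comm (signedPow r x)]
    convert this using 3 <;> ring

theorem abs_signedPow {r : ℝ} (hr : 0 < r) (x : ℝ) : |signedPow r x| = |x| ^ r := by
  rcases eq_or_ne x 0 with rfl | h
  · simp [signedPow, Real.zero_rpow hr.ne']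
  · have hx := (abs_pos.2 h).ne'
    rw [signedPow, abs_mul, abs_of_nonneg (Real.rpow_nonneg (abs_nonneg x) _),
      Real.rpow_sub_one hx, mul_div_cancel₀ _ hx]

end Pointwise

open Filter Topology

/-! ### Variable exponent Lebesgue modulars -/

section Leb

variable {α : Type*} [MeasurableSpace α] {μ : Measure α} {r : α → ℝ} {a b : ℝ}

/-- The space of the a.e. measurable functions. -/
def aeMeas (μ : Measure α) : Submodule ℝ (α → ℝ) where
  carrier := {f | AEMeasurable f μ}
  zero_mem' := aemeasurable_const
  add_mem' := AEMeasurable.add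
  smul_mem' c _ hf := AEMeasurable.const_smul hf c

theorem mem_aeMeas {f : α → ℝ} : f ∈ aeMeas μ ↔ AEMeasurable f μ := Iff.rfl

theorem aemeasurable_ofReal_rpow (hr : AEMeasurable r μ) {f : α → ℝ} (hf : AEMeasurable f μ) :
    AEMeasurable (fun x => ENNReal.ofReal (|f x| ^ r x)) μ := by
  simpa only [Real.norm_eq_abs] using (hf.norm.pow hr).ennreal_ofReal

theorem lebModular_mono_ae {f g : α → ℝ} (hr : ∀ᵐ x ∂μ, 0 ≤ r x) (h : ∀ᵐ x ∂μ, |f x| ≤ |g x|) :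
    lebModular μ r f ≤ lebModular μ r g := by
  refine lintegral_mono_ae ?_
  filter_upwards [hr, h] with x hx hx'
  exact ENNReal.ofReal_le_ofReal (Real.rpow_le_rpow (abs_nonneg _) hx' hx)

theorem lebModular_congr_ae {f g : α → ℝ} (h : f =ᵐ[μ] g) :
    lebModular μ r f = lebModular μ r g := by
  refine lintegral_congr_ae ?_
  filter_upwards [h] with x hx
  rw [hx]

theorem isModularOn_lebModular (ha : 1 < a) (hb : 0 < b) (hr : AEMeasurable r μ)
    (hab : ∀ᵐ x ∂μ, a ≤ r x ∧ r x ≤ b) : IsModularOn (aeMeas μ) (lebModular μ r) b where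
  pos := hb
  map_zero := by
    refine (lintegral_eq_zero_iff' (aemeasurable_ofReal_rpow hr aemeasurable_const)).2 ?_
    filter_upwards [hab] with x hx
    have : r x ≠ 0 := by linarith
    change ENNReal.ofReal (|(0 : ℝ)| ^ r x) = 0
    simp [Real.zero_rpow this]
  map_neg u := by simp [lebModular]
  convex u hu v hv s t hs ht hst := by
    have hu' := aemeasurable_ofReal_rpow hr hu
    calc lebModular μ r (s • u + t • v)
        ≤ ∫⁻ x, ENNReal.ofReal s * ENNReal.ofReal (|u x| ^ r x) +
            ENNReal.ofReal t * ENNReal.ofReal (|v x| ^ r x) ∂μ := by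
          refine lintegral_mono_ae ?_
          filter_upwards [hab] with x hx
          rw [← ENNReal.ofReal_mul hs, ← ENNReal.ofReal_mul ht,
            ← ENNReal.ofReal_add (by positivity) (by positivity)]
          exact ENNReal.ofReal_le_ofReal (abs_convex_rpow_le (by linarith) _ _ hs ht hst)
      _ = _ := by
          rw [lintegral_add_left' (hu'.const_mul _), lintegral_const_mul' _ _ ENNReal.ofReal_ne_top,
            lintegral_const_mul' _ _ ENNReal.ofReal_ne_top]
          rfl
  growth u hu c hc := by
    rw [lebModular, lebModular, ← lintegral_const_mul' _ _ ENNReal.ofReal_ne_top]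
    refine lintegral_mono_ae ?_
    filter_upwards [hab] with x hx
    have hc0 : 0 ≤ c := by linarith
    rw [← ENNReal.ofReal_mul (by positivity)]
    refine ENNReal.ofReal_le_ofReal ?_
    rw [Pi.smul_apply, smul_eq_mul, abs_mul, abs_of_nonneg hc0,
      Real.mul_rpow hc0 (abs_nonneg _)]
    gcongr
    exact hx.2
  uniform θ hθ := by
    obtain ⟨K₀, hK₀, hK⟩ := abs_rpow_uniformConvex (b := b) ha hθ
    refine ⟨K₀, hK₀, fun K hKK u hu v hv => ?_⟩
    have hK0 : 0 ≤ K := by linarith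
    have hd := aemeasurable_ofReal_rpow hr (AEMeasurable.sub hu hv)
    have hu' := aemeasurable_ofReal_rpow hr hu
    rw [lebModular, lebModular, lebModular, lebModular,
      ← lintegral_const_mul' _ _ ENNReal.ofReal_ne_top, ← lintegral_add_left' hd,
      ← lintegral_add_left' hu', ← lintegral_const_mul' _ _ ENNReal.ofReal_ne_top]
    refine lintegral_mono_ae ?_
    filter_upwards [hab] with x hx
    rw [← ENNReal.ofReal_mul hK0, ← ENNReal.ofReal_add (by positivity) (by positivity),
      ← ENNReal.ofReal_add (by positivity) (by positivity), ← ENNReal.ofReal_mul (by positivity)]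
    refine ENNReal.ofReal_le_ofReal (le_trans (le_of_eq ?_) (hK K hKK (r x) hx.1 hx.2 (u x) (v x)))
    simp only [Pi.sub_apply, Pi.smul_apply, Pi.add_apply, smul_eq_mul]
    rw [show 1 / 2 * (u x + v x) = (u x + v x) / 2 by ring]

theorem lebNorm_eq_lux (f : α → ℝ) : lebNorm μ r f = lux (lebModular μ r) f := by
  have : ∀ t : ℝ, (fun x => f x / t) = t⁻¹ • f := fun t => by
    funext x; simp [div_eq_inv_mul]
  simp only [lebNorm, lux, this]

theorem tendsto_ofReal_abs_rpow {r : ℝ} (hr : 0 < r) {f : ℕ → ℝ} {l : ℝ}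
    (h : Tendsto f atTop (𝓝 l)) :
    Tendsto (fun k => ENNReal.ofReal (|f k| ^ r)) atTop (𝓝 (ENNReal.ofReal (|l| ^ r))) :=
  (ENNReal.continuous_ofReal.tendsto _).comp
    (((Real.continuousAt_rpow_const |l| r (Or.inr hr.le)).tendsto).comp h.abs)

theorem lebModular_le_liminf (hr : AEMeasurable r μ) (hr0 : ∀ᵐ x ∂μ, 0 < r x)
    {f : ℕ → α → ℝ} {g : α → ℝ} (hf : ∀ k, AEMeasurable (f k) μ)
    (h : ∀ᵐ x ∂μ, Tendsto (fun k => f k x) atTop (𝓝 (g x))) :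
    lebModular μ r g ≤ liminf (fun k => lebModular μ r (f k)) atTop := by
  refine le_trans (lintegral_mono_ae ?_)
    (lintegral_liminf_le' fun k => aemeasurable_ofReal_rpow hr (hf k))
  filter_upwards [h, hr0] with x hx hx0
  exact (tendsto_ofReal_abs_rpow hx0 hx).liminf_eq.ge

/-- The sum may be taken under the integral, so it is finite a.e. and its terms tend to zero.
Applied to functions scaled by `2 ^ k`, this yields geometric pointwise decay. -/
theorem ae_tendsto_zero_of_tsum (hr : AEMeasurable r μ) (hr0 : ∀ᵐ x ∂μ, 0 < r x)
    {f : ℕ → α → ℝ} (hf : ∀ k, AEMeasurable (f k) μ)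
    (h : ∑' k, lebModular μ r (f k) ≠ ∞) :
    ∀ᵐ x ∂μ, ∑' k, ENNReal.ofReal (|f k x| ^ r x) ≠ ∞ ∧ ∀ᶠ k in atTop, |f k x| ≤ 1 := by
  have hm : ∀ k, AEMeasurable (fun x => ENNReal.ofReal (|f k x| ^ r x)) μ := fun k =>
    aemeasurable_ofReal_rpow hr (hf k)
  have h1 : ∫⁻ x, ∑' k, ENNReal.ofReal (|f k x| ^ r x) ∂μ ≠ ∞ := by
    rwa [lintegral_tsum hm]
  filter_upwards [ae_lt_top' (AEMeasurable.tsum hm) h1, hr0] with x hx hx0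
  refine ⟨hx.ne, ?_⟩
  have h2 := ENNReal.tendsto_atTop_zero_of_tsum_ne_top hx.ne
  filter_upwards [h2.eventually (ge_mem_nhds one_pos)] with k hk
  by_contra! hc
  exact absurd (ENNReal.ofReal_le_one.1 hk) (not_le.2 (Real.one_lt_rpow hc hx0))

/-- Dominated convergence: a sequence that is dominated by a rapidly convergent one. -/
theorem tendsto_lebModular_sub (ha : 1 < a) (hr : AEMeasurable r μ)
    (hab : ∀ᵐ x ∂μ, a ≤ r x ∧ r x ≤ b)
    {f g : ℕ → α → ℝ} {f₀ g₀ : α → ℝ} (hf : ∀ k, AEMeasurable (f k) μ)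
    (hf₀ : AEMeasurable f₀ μ) (hg : ∀ k, AEMeasurable (g k) μ) (hg₀ : AEMeasurable g₀ μ)
    (hsum : ∑' k, lebModular μ r (f k - f₀) ≠ ∞) (hfin : lebModular μ r f₀ ≠ ∞)
    (hgf : ∀ k x, |g k x| ≤ |f k x|) (hgf₀ : ∀ x, |g₀ x| ≤ |f₀ x|)
    (hlim : ∀ᵐ x ∂μ, Tendsto (fun k => g k x) atTop (𝓝 (g₀ x))) :
    Tendsto (fun k => lebModular μ r (g k - g₀)) atTop (𝓝 0) := by
  have hm : ∀ k, AEMeasurable (fun x => ENNReal.ofReal (|(f k - f₀) x| ^ r x)) μ := fun k =>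
    aemeasurable_ofReal_rpow hr ((hf k).sub hf₀)
  have hm0 := aemeasurable_ofReal_rpow hr hf₀
  set C : ℝ≥0∞ := ENNReal.ofReal (2 ^ b)
  -- The majorant comes from `|g k - g₀| ≤ |f k - f₀| + 2 |f₀|` and two uses of `abs_add_rpow_le`.
  -- Summing over all `k` makes it independent of `k`; it stays integrable by `hsum`.
  set G : α → ℝ≥0∞ := fun x => C * (∑' k, ENNReal.ofReal (|(f k - f₀) x| ^ r x) +
    C * (ENNReal.ofReal (|f₀ x| ^ r x) + ENNReal.ofReal (|f₀ x| ^ r x))) with hG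
  have hGfin : ∫⁻ x, G x ∂μ ≠ ∞ := by
    rw [hG, lintegral_const_mul' _ _ ENNReal.ofReal_ne_top,
      lintegral_add_left' (AEMeasurable.tsum hm),
      lintegral_const_mul' _ _ ENNReal.ofReal_ne_top, lintegral_add_left' hm0,
      lintegral_tsum hm]
    refine ENNReal.mul_ne_top ENNReal.ofReal_ne_top (ENNReal.add_ne_top.2 ⟨hsum, ?_⟩)
    exact ENNReal.mul_ne_top ENNReal.ofReal_ne_top (ENNReal.add_ne_top.2 ⟨hfin, hfin⟩)
  have hbound : ∀ k, ∀ᵐ x ∂μ, ENNReal.ofReal (|(g k - g₀) x| ^ r x) ≤ G x := by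
    intro k
    filter_upwards [hab] with x hx
    have h1 : 1 ≤ r x := by linarith
    have h2 : |(g k - g₀) x| ≤ abs (|(f k - f₀) x| + (|f₀ x| + |f₀ x|)) := by
      rw [abs_of_nonneg (a := |(f k - f₀) x| + (|f₀ x| + |f₀ x|)) (by positivity)]
      refine (abs_sub _ _).trans ?_
      have h3 : |f k x| ≤ |(f k - f₀) x| + |f₀ x| := by
        simpa using abs_add_le ((f k - f₀) x) (f₀ x)
      linarith [hgf k x, hgf₀ x]
    have h4 := abs_add_rpow_le h1 hx.2 |(f k - f₀) x| (|f₀ x| + |f₀ x|)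
    have h5 := abs_add_rpow_le h1 hx.2 |f₀ x| |f₀ x|
    simp only [abs_abs] at h4 h5
    have hC : (0 : ℝ) ≤ 2 ^ b := by positivity
    have h6 := (Real.rpow_le_rpow (abs_nonneg _) h2 (by linarith)).trans
      (h4.trans (mul_le_mul_of_nonneg_left (add_le_add le_rfl h5) hC))
    refine (ENNReal.ofReal_le_ofReal h6).trans ?_
    rw [ENNReal.ofReal_mul hC, ENNReal.ofReal_add (by positivity) (by positivity),
      ENNReal.ofReal_mul hC, ENNReal.ofReal_add (by positivity) (by positivity)]
    refine mul_le_mul_right (add_le_add ?_ le_rfl) _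
    exact ENNReal.le_tsum k
  have := tendsto_lintegral_of_dominated_convergence' (F := fun k x =>
    ENNReal.ofReal (|(g k - g₀) x| ^ r x)) (f := fun _ => 0) (μ := μ) G
    (fun k => aemeasurable_ofReal_rpow hr ((hg k).sub hg₀)) hbound hGfin ?_
  · rwa [lintegral_zero] at this
  · filter_upwards [hlim, hab] with x hx hx'
    have h1 : Tendsto (fun k => (g k - g₀) x) atTop (𝓝 0) := by
      simpa using hx.sub_const (g₀ x)
    have h0 : 0 < r x := by linarith
    simpa [Real.zero_rpow h0.ne'] using tendsto_ofReal_abs_rpow h0 h1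

end Leb

namespace IsModularOn

variable {V V' : Type*} [AddCommGroup V] [Module ℝ V] [AddCommGroup V'] [Module ℝ V']
  {M : Submodule ℝ V} {ρ : V → ℝ≥0∞} {b : ℝ}

theorem comp (h : IsModularOn M ρ b) (T : V' →ₗ[ℝ] V) {M' : Submodule ℝ V'}
    (hM : ∀ u ∈ M', T u ∈ M) : IsModularOn M' (fun u => ρ (T u)) b where
  pos := h.pos
  map_zero := by rw [_root_.map_zero, h.map_zero]
  map_neg u := by rw [_root_.map_neg, h.map_neg]
  convex u hu v hv s t hs ht hst := by
    simpa using h.convex _ (hM u hu) _ (hM v hv) s t hs ht hst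
  growth u hu c hc := by simpa using h.growth _ (hM u hu) c hc
  uniform θ hθ := by
    obtain ⟨K₀, h0, hK⟩ := h.uniform θ hθ
    exact ⟨K₀, h0, fun K hKK u hu v hv => by simpa using hK K hKK _ (hM u hu) _ (hM v hv)⟩

/-- Small Luxembourg norms along a sequence give small modulars of multiples. -/
theorem le_of_lux_le_pow (h : IsModularOn M ρ b) {u : V} (hu : u ∈ h.dom) (k : ℕ)
    (hl : lux ρ u ≤ (1 / 4) ^ k) : ρ ((2 : ℝ) ^ k • u) ≤ ENNReal.ofReal ((1 / 2) ^ k) := by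
  refine h.le_of_lux_le (h.dom.smul_mem _ hu) (by positivity)
    (pow_le_one₀ (by norm_num) (by norm_num)) ?_
  rw [h.lux_smul hu, abs_of_pos (by positivity)]
  calc (2 : ℝ) ^ k * lux ρ u ≤ 2 ^ k * (1 / 4) ^ k := by gcongr
    _ = _ := by rw [← mul_pow]; norm_num

end IsModularOn

/-- Tail infima increase with the index, so their suprema add. This combines the two Fatou bounds
for the two parts of the modular. -/
theorem liminf_add_liminf_le {u v : ℕ → ℝ≥0∞} {C : ℝ≥0∞} (h : ∀ k, u k + v k ≤ C) :
    liminf u atTop + liminf v atTop ≤ C := by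
  rw [liminf_eq_iSup_iInf_of_nat, liminf_eq_iSup_iInf_of_nat,
    ENNReal.iSup_add_iSup_of_monotone]
  · exact iSup_le fun k => (add_le_add (iInf₂_le k le_rfl) (iInf₂_le k le_rfl)).trans (h k)
  all_goals
    exact fun i j hij => le_iInf₂ fun k hk => iInf₂_le k (hij.trans hk)

theorem tsum_ofReal_half_pow_ne_top : ∑' k : ℕ, ENNReal.ofReal ((1 / 2) ^ k) ≠ ∞ := by
  rw [← ENNReal.ofReal_tsum_of_nonneg (fun k => by positivity) summable_geometric_two]
  exact ENNReal.ofReal_ne_top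

/-! ### The fractional modular and the space $\mathcal W(\Omega)$ -/

variable {n : ℕ}

/-- The fractional difference quotient, as a linear map. -/
def gagQuot (s : ℝ) (p : E n × E n → ℝ) : (E n → ℝ) →ₗ[ℝ] (E n × E n → ℝ) where
  toFun u z := (u z.1 - u z.2) / ‖z.1 - z.2‖ ^ (s + n / p z)
  map_add' u v := by funext z; simp only [Pi.add_apply]; ring
  map_smul' c u := by
    funext z; simp only [Pi.smul_apply, smul_eq_mul, RingHom.id_apply]; ring

theorem gagQuot_apply (s : ℝ) (p : E n × E n → ℝ) (u : E n → ℝ) (z : E n × E n) :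
    gagQuot s p u z = (u z.1 - u z.2) / ‖z.1 - z.2‖ ^ (s + n / p z) := rfl

/-- The two exponents are measurable with values a.e. in the interval `[a, b]`, `1 < a`. -/
structure Bounds (Ω : Set (E n)) (q : E n → ℝ) (p : E n × E n → ℝ) (a b : ℝ) : Prop where
  one_lt : 1 < a
  pos : 0 < b
  qm : AEMeasurable q (leb Ω)
  qb : ∀ᵐ x ∂(leb Ω), a ≤ q x ∧ q x ≤ b
  pm : AEMeasurable p (leb₂ Ω)
  pb : ∀ᵐ x ∂(leb₂ Ω), a ≤ p x ∧ p x ≤ b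

theorem exists_bounds {Ω : Set (E n)} {q : E n → ℝ} {p : E n × E n → ℝ}
    (hq : IsExponent (leb Ω) q) (hp : IsExponent (leb₂ Ω) p) : ∃ a b, Bounds Ω q p a b := by
  obtain ⟨hqm, a₁, b₁, h1, hq⟩ := hq
  obtain ⟨hpm, a₂, b₂, h2, hp⟩ := hp
  refine ⟨min a₁ a₂, max (max b₁ b₂) 1, lt_min h1 h2, lt_max_of_lt_right one_pos, hqm, ?_, hpm, ?_⟩
  · filter_upwards [hq] with x hx
    exact ⟨(min_le_left _ _).trans hx.1, hx.2.trans ((le_max_left _ _).trans (le_max_left _ _))⟩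
  · filter_upwards [hp] with x hx
    exact ⟨(min_le_right _ _).trans hx.1, hx.2.trans ((le_max_right _ _).trans (le_max_left _ _))⟩

theorem ae_prod_of_ae {Ω : Set (E n)} {P : E n → Prop} (h : ∀ᵐ x ∂(leb Ω), P x) :
    ∀ᵐ z ∂(leb₂ Ω), P z.1 ∧ P z.2 :=
  (Measure.quasiMeasurePreserving_fst.ae h).and (Measure.quasiMeasurePreserving_snd.ae h)

theorem gagQuot_congr_ae {Ω : Set (E n)} {s : ℝ} {p : E n × E n → ℝ} {u v : E n → ℝ}
    (h : u =ᵐ[leb Ω] v) : gagQuot s p u =ᵐ[leb₂ Ω] gagQuot s p v := by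
  filter_upwards [ae_prod_of_ae h] with z hz
  rw [gagQuot_apply, gagQuot_apply, hz.1, hz.2]

theorem abs_gagQuot_abs_le (s : ℝ) (p : E n × E n → ℝ) (u : E n → ℝ) (z : E n × E n) :
    |gagQuot s p (fun x => |u x|) z| ≤ |gagQuot s p u z| := by
  rw [gagQuot_apply, gagQuot_apply, abs_div, abs_div]
  exact div_le_div_of_nonneg_right (abs_abs_sub_abs_le _ _) (abs_nonneg _)

namespace Bounds

variable {Ω : Set (E n)} {q : E n → ℝ} {p : E n × E n → ℝ} {a b : ℝ} (H : Bounds Ω q p a b)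
  (s : ℝ)
include H

theorem aemeasurable_gagQuot {u : E n → ℝ} (hu : AEMeasurable u (leb Ω)) :
    AEMeasurable (gagQuot s p u) (leb₂ Ω) := by
  refine AEMeasurable.div ?_ ?_
  · exact (hu.comp_quasiMeasurePreserving Measure.quasiMeasurePreserving_fst).sub
      (hu.comp_quasiMeasurePreserving Measure.quasiMeasurePreserving_snd)
  · exact AEMeasurable.pow (by fun_prop) ((H.pm.const_div _).const_add _)

/-- The kernel is a power of the weight of the quotient: `(s + n / p) * p = n + s * p`, where `p ≠
0`. All properties of the Gagliardo modular are then pulled back from the Lebesgue modular along the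
linear map `gagQuot`. -/
theorem gagModular_eq : gagModular Ω s p = fun u => lebModular (leb₂ Ω) p (gagQuot s p u) := by
  funext u
  refine lintegral_congr_ae ?_
  filter_upwards [H.pb] with z hz
  have hp0 : 0 < p z := by linarith [H.one_lt, hz.1]
  have hn := norm_nonneg (z.1 - z.2)
  rw [gagQuot_apply, abs_div, abs_of_nonneg (Real.rpow_nonneg hn _),
    Real.div_rpow (abs_nonneg _) (Real.rpow_nonneg hn _), ← Real.rpow_mul hn]
  congr 3
  field_simp
  ring

theorem modQ : IsModularOn (aeMeas (leb Ω)) (lebModular (leb Ω) q) b :=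
  isModularOn_lebModular H.one_lt H.pos H.qm H.qb

theorem modP' : IsModularOn (aeMeas (leb₂ Ω)) (lebModular (leb₂ Ω) p) b :=
  isModularOn_lebModular H.one_lt H.pos H.pm H.pb

theorem modP : IsModularOn (aeMeas (leb Ω)) (gagModular Ω s p) b := by
  rw [H.gagModular_eq s]
  exact H.modP'.comp (gagQuot s p) fun u hu => H.aemeasurable_gagQuot s hu

theorem mod : IsModularOn (aeMeas (leb Ω)) (modular Ω s q p) b :=
  H.modQ.add (H.modP s)

/-- The space `W^{s,q(.),p(.,.)}(Ω)`. -/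
abbrev dom : Submodule ℝ (E n → ℝ) := (H.mod s).dom

theorem modular_eq (u : E n → ℝ) : modular Ω s q p u =
    lebModular (leb Ω) q u + lebModular (leb₂ Ω) p (gagQuot s p u) := by
  rw [modular, H.gagModular_eq s]

theorem dom_le_domQ : H.dom s ≤ H.modQ.dom := fun _ hu => ⟨hu.1, lt_of_le_of_lt le_self_add hu.2⟩

theorem dom_le_domP : H.dom s ≤ (H.modP s).dom :=
  fun _ hu => ⟨hu.1, lt_of_le_of_lt le_add_self hu.2⟩

theorem gagQuot_mem_dom {u : E n → ℝ} (hu : u ∈ H.dom s) : gagQuot s p u ∈ H.modP'.dom := by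
  refine ⟨H.aemeasurable_gagQuot s hu.1, ?_⟩
  have := (H.dom_le_domP s hu).2
  rwa [H.gagModular_eq s] at this

/-- Membership asks only for some multiple to have finite modular; by the growth bound all multiples
then do. -/
theorem memW_iff {u : E n → ℝ} : MemW Ω s q p u ↔ u ∈ H.dom s := by
  have habs : (fun z : E n × E n => |u z.1 - u z.2| / ‖z.1 - z.2‖ ^ (s + n / p z)) =
      fun z => |gagQuot s p u z| := by
    funext z
    rw [gagQuot_apply, abs_div, abs_of_nonneg (Real.rpow_nonneg (norm_nonneg _) _)]
  have hpabs : ∀ t : ℝ, lebModular (leb₂ Ω) p (fun z => t * |gagQuot s p u z|) =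
      lebModular (leb₂ Ω) p (t • gagQuot s p u) := fun t => by
    simp [lebModular, abs_mul]
  constructor
  · rintro ⟨⟨hu, t, ht, htf⟩, -, t', ht', htf'⟩
    have hu' : AEMeasurable u (leb Ω) := hu.aemeasurable
    rw [habs] at htf'
    rw [hpabs] at htf'
    have h1 := H.modQ.smul_lt_top ((aeMeas _).smul_mem t hu') htf t⁻¹
    have h2 := H.modP'.smul_lt_top
      ((aeMeas _).smul_mem t' (H.aemeasurable_gagQuot s hu')) htf' t'⁻¹
    rw [smul_smul, inv_mul_cancel₀ ht'.ne', one_smul] at h2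
    rw [smul_smul, inv_mul_cancel₀ ht.ne', one_smul] at h1
    refine ⟨hu', ?_⟩
    rw [H.modular_eq]
    exact ENNReal.add_lt_top.2 ⟨h1, h2⟩
  · intro hu
    refine ⟨⟨hu.1.aestronglyMeasurable, 1, one_pos, ?_⟩, ?_, 1, one_pos, ?_⟩
    · simpa using (H.dom_le_domQ s hu).2
    · rw [habs]
      have := (H.aemeasurable_gagQuot s hu.1).norm.aestronglyMeasurable
      simpa only [Real.norm_eq_abs] using this
    · rw [habs]
      rw [hpabs, one_smul]
      exact (H.gagQuot_mem_dom s hu).2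

end Bounds

theorem gagSeminorm_eq_lux (Ω : Set (E n)) (s : ℝ) (p : E n × E n → ℝ) (u : E n → ℝ) :
    gagSeminorm Ω s p u = lux (gagModular Ω s p) u := by
  have : ∀ t : ℝ, (fun x => u x / t) = t⁻¹ • u := fun t => by
    funext x; simp [div_eq_inv_mul]
  simp only [gagSeminorm, lux, this]

theorem modularNorm_eq_lux (Ω : Set (E n)) (s : ℝ) (q : E n → ℝ) (p : E n × E n → ℝ)
    (u : E n → ℝ) : modularNorm Ω s q p u = lux (modular Ω s q p) u := by
  have : ∀ t : ℝ, (fun x => u x / t) = t⁻¹ • u := fun t => by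
    funext x; simp [div_eq_inv_mul]
  simp only [modularNorm, lux, this]

theorem modularNorm_nonneg (Ω : Set (E n)) (s : ℝ) (q : E n → ℝ) (p : E n × E n → ℝ)
    (u : E n → ℝ) : 0 ≤ modularNorm Ω s q p u := by
  rw [modularNorm_eq_lux]; exact lux_nonneg _ _

theorem sumNorm_eq_lux (Ω : Set (E n)) (s : ℝ) (q : E n → ℝ) (p : E n × E n → ℝ)
    (u : E n → ℝ) :
    sumNorm Ω s q p u = lux (lebModular (leb Ω) q) u + lux (gagModular Ω s p) u := by
  rw [sumNorm, lebNorm_eq_lux, gagSeminorm_eq_lux]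

namespace Bounds

variable {Ω : Set (E n)} {q : E n → ℝ} {p : E n × E n → ℝ} {a b : ℝ} (H : Bounds Ω q p a b)
  {s : ℝ}
include H

theorem q_pos : ∀ᵐ x ∂(leb Ω), 0 < q x := by
  filter_upwards [H.qb] with x hx; linarith [H.one_lt]

theorem p_pos : ∀ᵐ x ∂(leb₂ Ω), 0 < p x := by
  filter_upwards [H.pb] with x hx; linarith [H.one_lt]

theorem modularNorm_le_sumNorm {u : E n → ℝ} (hu : u ∈ H.dom s) :
    modularNorm Ω s q p u ≤ sumNorm Ω s q p u := by
  rw [modularNorm_eq_lux, sumNorm_eq_lux]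
  exact H.modQ.lux_add_modular_le (H.modP s) hu

theorem sumNorm_le_modularNorm {u : E n → ℝ} (hu : u ∈ H.dom s) :
    sumNorm Ω s q p u ≤ 2 * modularNorm Ω s q p u := by
  rw [modularNorm_eq_lux, sumNorm_eq_lux, two_mul]
  exact add_le_add ((H.mod s).lux_mono hu fun c _ => le_self_add)
    ((H.mod s).lux_mono hu fun c _ => le_add_self)

theorem modular_congr_ae {u v : E n → ℝ} (h : u =ᵐ[leb Ω] v) :
    modular Ω s q p u = modular Ω s q p v := by
  rw [H.modular_eq, H.modular_eq, lebModular_congr_ae h, lebModular_congr_ae (gagQuot_congr_ae h)]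

theorem mem_dom_congr_ae {u v : E n → ℝ} (h : u =ᵐ[leb Ω] v) (hu : u ∈ H.dom s) : v ∈ H.dom s :=
  ⟨AEMeasurable.congr hu.1 h, by rw [← H.modular_congr_ae h]; exact hu.2⟩

theorem modularNorm_congr_ae {u v : E n → ℝ} (h : u =ᵐ[leb Ω] v) :
    modularNorm Ω s q p u = modularNorm Ω s q p v := by
  have : ∀ t : ℝ, modular Ω s q p (fun x => u x / t) = modular Ω s q p (fun x => v x / t) :=
    fun t => H.modular_congr_ae (h.mono fun x hx => by simp only [hx])
  simp only [modularNorm, this]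

theorem sumNorm_congr_ae {u v : E n → ℝ} (h : u =ᵐ[leb Ω] v) :
    sumNorm Ω s q p u = sumNorm Ω s q p v := by
  have h1 : ∀ t : ℝ, lebModular (leb Ω) q (fun x => u x / t) =
      lebModular (leb Ω) q (fun x => v x / t) :=
    fun t => lebModular_congr_ae (h.mono fun x hx => by simp only [hx])
  have h2 : ∀ t : ℝ, gagModular Ω s p (fun x => u x / t) =
      gagModular Ω s p (fun x => v x / t) := fun t => by
    rw [H.gagModular_eq s]
    exact lebModular_congr_ae (gagQuot_congr_ae (h.mono fun x hx => by simp only [hx]))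
  simp only [sumNorm, lebNorm, gagSeminorm, h1, h2]

theorem modular_abs_le (u : E n → ℝ) :
    modular Ω s q p (fun x => |u x|) ≤ modular Ω s q p u := by
  rw [H.modular_eq, H.modular_eq]
  refine add_le_add (lebModular_mono_ae (H.q_pos.mono fun x hx => hx.le) ?_)
    (lebModular_mono_ae (H.p_pos.mono fun x hx => hx.le) ?_)
  · exact Eventually.of_forall fun x => by rw [abs_abs]
  · exact Eventually.of_forall fun z => abs_gagQuot_abs_le s p u z

theorem abs_mem_dom {u : E n → ℝ} (hu : u ∈ H.dom s) : (fun x => |u x|) ∈ H.dom s :=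
  ⟨AEMeasurable.norm hu.1,
    (H.modular_abs_le u).trans_lt hu.2⟩

theorem modularNorm_abs_le {u : E n → ℝ} (hu : u ∈ H.dom s) :
    modularNorm Ω s q p (fun x => |u x|) ≤ modularNorm Ω s q p u := by
  rw [modularNorm_eq_lux, modularNorm_eq_lux]
  refine (H.mod s).lux_mono hu fun c hc => ?_
  have : c • (fun x => |u x|) = fun x => |(c • u) x| := by
    funext x; simp [abs_mul, abs_of_pos hc]
  rw [this]
  exact H.modular_abs_le _

theorem ae_eq_zero_of_modularNorm {u : E n → ℝ} (hu : u ∈ H.dom s)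
    (h : modularNorm Ω s q p u = 0) : u =ᵐ[leb Ω] 0 := by
  rw [modularNorm_eq_lux] at h
  have h1 := (H.mod s).eq_zero_of_lux_eq_zero hu h
  have h2 : lebModular (leb Ω) q u = 0 := (add_eq_zero.1 h1).1
  rw [lebModular, lintegral_eq_zero_iff' (aemeasurable_ofReal_rpow H.qm hu.1)] at h2
  filter_upwards [h2, H.q_pos] with x hx hq
  by_contra h0
  have : 0 < |u x| ^ q x := Real.rpow_pos_of_pos (abs_pos.2 h0) _
  simp only [Pi.zero_apply, ENNReal.ofReal_eq_zero] at hx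
  linarith

/-- Lower semicontinuity of the modular. -/
theorem modular_le_of_tendsto_ae {f : ℕ → E n → ℝ} {g : E n → ℝ} {C : ℝ≥0∞}
    (hf : ∀ k, AEMeasurable (f k) (leb Ω)) (hC : ∀ k, modular Ω s q p (f k) ≤ C)
    (h : ∀ᵐ x ∂(leb Ω), Tendsto (fun k => f k x) atTop (𝓝 (g x))) :
    modular Ω s q p g ≤ C := by
  rw [H.modular_eq]
  refine le_trans (add_le_add (lebModular_le_liminf H.qm H.q_pos hf h)
    (lebModular_le_liminf H.pm H.p_pos (fun k => H.aemeasurable_gagQuot s (hf k)) ?_))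
    (liminf_add_liminf_le fun k => ?_)
  · filter_upwards [ae_prod_of_ae h] with z hz
    exact (hz.1.sub hz.2).div_const _
  · exact (H.modular_eq s _).symm.trans_le (hC k)

theorem modularNorm_le_of_tendsto_ae {f : ℕ → E n → ℝ} {g : E n → ℝ} {t : ℝ} (ht : 0 < t)
    (hf : ∀ k, f k ∈ H.dom s) (hC : ∀ k, modularNorm Ω s q p (f k) ≤ t)
    (h : ∀ᵐ x ∂(leb Ω), Tendsto (fun k => f k x) atTop (𝓝 (g x))) :
    modularNorm Ω s q p g ≤ t := by
  rw [modularNorm_eq_lux]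
  refine lux_le ht (H.modular_le_of_tendsto_ae (f := fun k => t⁻¹ • f k)
    (fun k => AEMeasurable.const_smul (hf k).1 _) (fun k => ?_) ?_)
  · exact ((H.mod s).lux_le_iff (hf k) ht).1 (by rw [← modularNorm_eq_lux]; exact hC k)
  · filter_upwards [h] with x hx
    exact hx.const_mul _

theorem tsum_modular_ne_top {h : ℕ → E n → ℝ} (hh : ∀ k, h k ∈ H.dom s)
    (hl : ∀ k, modularNorm Ω s q p (h k) ≤ (1 / 4) ^ k) :
    ∑' k, modular Ω s q p ((2 : ℝ) ^ k • h k) ≠ ∞ := by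
  refine ne_top_of_le_ne_top tsum_ofReal_half_pow_ne_top (ENNReal.tsum_le_tsum fun k => ?_)
  exact (H.mod s).le_of_lux_le_pow (hh k) k (by rw [← modularNorm_eq_lux]; exact hl k)

/-- A norm of at most `4⁻ᵏ` leaves room for the factor `2 ^ k`: the modulars of `2 ^ k • h k` are
still summable, so a.e. these functions are eventually at most `1`. -/
theorem ae_eventually_le {h : ℕ → E n → ℝ} (hh : ∀ k, h k ∈ H.dom s)
    (hl : ∀ k, modularNorm Ω s q p (h k) ≤ (1 / 4) ^ k) :
    ∀ᵐ x ∂(leb Ω), ∀ᶠ k in atTop, |h k x| ≤ (1 / 2) ^ k := by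
  have h1 : ∑' k, lebModular (leb Ω) q ((2 : ℝ) ^ k • h k) ≠ ∞ :=
    ne_top_of_le_ne_top (H.tsum_modular_ne_top hh hl) (ENNReal.tsum_le_tsum fun k => le_self_add)
  filter_upwards [ae_tendsto_zero_of_tsum H.qm H.q_pos
    (fun k => AEMeasurable.const_smul (hh k).1 _) h1] with x hx
  filter_upwards [hx.2] with k hk
  rw [Pi.smul_apply, smul_eq_mul, abs_mul, abs_of_pos (by positivity)] at hk
  rw [one_div, inv_pow, ← one_div, le_div_iff₀' (by positivity)]
  exact hk

theorem ae_exists_tendsto {w : ℕ → E n → ℝ} (hw : ∀ k, w k ∈ H.dom s)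
    (hl : ∀ k, modularNorm Ω s q p (w (k + 1) - w k) ≤ (1 / 4) ^ k) :
    ∀ᵐ x ∂(leb Ω), ∃ l, Tendsto (fun k => w k x) atTop (𝓝 l) := by
  filter_upwards [H.ae_eventually_le (fun k => (H.dom s).sub_mem (hw (k + 1)) (hw k)) hl] with x hx
  obtain ⟨K, hK⟩ := eventually_atTop.1 hx
  have hc : CauchySeq fun k => w (k + K) x := by
    refine cauchySeq_of_le_geometric (1 / 2) ((1 / 2) ^ K) (by norm_num) fun k => ?_
    rw [dist_comm, Real.dist_eq, ← pow_add, add_comm K k, add_right_comm k 1 K]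
    exact hK (k + K) (by omega)
  obtain ⟨l, hl⟩ := cauchySeq_tendsto_of_complete hc
  exact ⟨l, (tendsto_add_atTop_iff_nat K).1 hl⟩

theorem modularNorm_add_le {u v : E n → ℝ} (hu : u ∈ H.dom s) (hv : v ∈ H.dom s) :
    modularNorm Ω s q p (u + v) ≤ modularNorm Ω s q p u + modularNorm Ω s q p v := by
  simp only [modularNorm_eq_lux]
  exact (H.mod s).lux_add_le hu hv

theorem modularNorm_sub_le {u v w : E n → ℝ} (hu : u ∈ H.dom s) (hv : v ∈ H.dom s)
    (hw : w ∈ H.dom s) : modularNorm Ω s q p (u - w) ≤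
      modularNorm Ω s q p (u - v) + modularNorm Ω s q p (v - w) := by
  simp only [modularNorm_eq_lux]
  exact (H.mod s).lux_sub_le hu hv hw

theorem modularNorm_sub_comm (u v : E n → ℝ) :
    modularNorm Ω s q p (u - v) = modularNorm Ω s q p (v - u) := by
  simp only [modularNorm_eq_lux]
  exact (H.mod s).lux_sub_comm u v

theorem modularNorm_smul {u : E n → ℝ} (hu : u ∈ H.dom s) (c : ℝ) :
    modularNorm Ω s q p (c • u) = |c| * modularNorm Ω s q p u := by
  simp only [modularNorm_eq_lux]
  exact (H.mod s).lux_smul hu c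

/-- A rapid Cauchy sequence converges in norm to its pointwise limit. -/
theorem limit_mem_dom {w : ℕ → E n → ℝ} (hw : ∀ k, w k ∈ H.dom s)
    (hl : ∀ k, modularNorm Ω s q p (w (k + 1) - w k) ≤ (1 / 4) ^ k) {v : E n → ℝ}
    (hv : ∀ᵐ x ∂(leb Ω), Tendsto (fun k => w k x) atTop (𝓝 (v x))) :
    v ∈ H.dom s ∧ ∀ k, modularNorm Ω s q p (v - w k) ≤ 2 * (1 / 4) ^ k := by
  have hvm : AEMeasurable v (leb Ω) := aemeasurable_of_tendsto_metrizable_ae' (fun k => (hw k).1) hv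
  -- The subtracted term makes the telescoping induction close: one step of the bound gains `3 / 2`
  -- times `(1 / 4) ^ (k + i)`, and only one such term is needed.
  have h1 : ∀ k i, modularNorm Ω s q p (w (k + i) - w k) ≤
      2 * (1 / 4) ^ k - 2 * (1 / 4) ^ (k + i) := by
    intro k i
    induction i with
    | zero =>
      have := H.modularNorm_smul (s := s) (H.dom s).zero_mem 0
      simp only [add_zero, sub_self]
      simp at this
      exact this.le
    | succ i ih =>
      have h2 := H.modularNorm_sub_le (hw (k + i + 1)) (hw (k + i)) (hw k)
      have h3 := hl (k + i)
      have h4 : (0 : ℝ) < (1 / 4) ^ (k + i) := by positivity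
      rw [← add_assoc, pow_succ]
      linarith
  have h2 : ∀ k, modularNorm Ω s q p (v - w k) ≤ 2 * (1 / 4) ^ k := by
    intro k
    refine H.modularNorm_le_of_tendsto_ae (f := fun i => w (k + i) - w k) (by positivity)
      (fun i => (H.dom s).sub_mem (hw _) (hw _)) (fun i => (h1 k i).trans ?_) ?_
    · have : (0 : ℝ) < (1 / 4) ^ (k + i) := by positivity
      linarith
    · filter_upwards [hv] with x hx
      have := hx.comp (tendsto_add_atTop_nat k)
      simp only [Function.comp_def, add_comm _ k] at this
      exact this.sub_const _
  refine ⟨?_, h2⟩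
  -- The norm bound alone does not give finite modular, since the infimum of the empty set is `0`.
  -- Fatou's lemma bounds the modular of half the difference by `1`, and doubling costs at most `2 ^
  -- b`.
  have h3 : v - w 0 ∈ H.dom s := by
    refine ⟨AEMeasurable.sub hvm (hw 0).1, ?_⟩
    refine lt_of_le_of_lt (b := ENNReal.ofReal (2 ^ b)) ?_ ENNReal.ofReal_lt_top
    have h5 : modular Ω s q p ((2 : ℝ)⁻¹ • (v - w 0)) ≤ 1 := by
      refine H.modular_le_of_tendsto_ae (f := fun i => (2 : ℝ)⁻¹ • (w i - w 0))
        (fun i => AEMeasurable.const_smul (AEMeasurable.sub (hw i).1 (hw 0).1) _) (fun i => ?_) ?_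
      · refine ((H.mod s).lux_le_iff ((H.dom s).sub_mem (hw i) (hw 0)) two_pos).1 ?_
        rw [← modularNorm_eq_lux]
        have h6 := h1 0 i
        rw [zero_add, pow_zero] at h6
        have : (0 : ℝ) < (1 / 4) ^ i := by positivity
        linarith
      · filter_upwards [hv] with x hx
        exact (hx.sub_const _).const_mul _
    have h6 := (H.mod s).growth ((2 : ℝ)⁻¹ • (v - w 0))
      (AEMeasurable.const_smul (AEMeasurable.sub hvm (hw 0).1) _) 2 one_le_two
    rw [smul_smul, mul_inv_cancel₀ two_ne_zero, one_smul] at h6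
    exact h6.trans ((mul_le_mul_right h5 _).trans_eq (mul_one _))
  simpa using (H.dom s).add_mem h3 (hw 0)

/-- Continuity of the absolute value along rapidly convergent sequences. -/
theorem tendsto_modular_abs_sub {w : ℕ → E n → ℝ} {v : E n → ℝ} (hw : ∀ k, w k ∈ H.dom s)
    (hv : v ∈ H.dom s) (hl : ∀ k, modularNorm Ω s q p (w k - v) ≤ (1 / 4) ^ k) :
    Tendsto (fun k => modular Ω s q p ((fun x => |w k x|) - fun x => |v x|)) atTop (𝓝 0) := by
  have hd : ∀ k, w k - v ∈ H.dom s := fun k => (H.dom s).sub_mem (hw k) hv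
  have hsum : ∑' k, modular Ω s q p (w k - v) ≠ ∞ := by
    refine ne_top_of_le_ne_top (H.tsum_modular_ne_top hd hl) (ENNReal.tsum_le_tsum fun k => ?_)
    have h1 := (H.mod s).smul_le (u := (2 : ℝ) ^ k • (w k - v)) (c := ((2 : ℝ) ^ k)⁻¹)
      ((aeMeas _).smul_mem _ (hd k).1) (by positivity)
      (inv_le_one_of_one_le₀ (one_le_pow₀ one_le_two))
    rw [smul_smul, inv_mul_cancel₀ (by positivity), one_smul] at h1
    refine h1.trans (mul_le_of_le_one_left' ?_)
    exact ENNReal.ofReal_le_one.2 (inv_le_one_of_one_le₀ (one_le_pow₀ one_le_two))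
  have hq : ∑' k, lebModular (leb Ω) q (w k - v) ≠ ∞ :=
    ne_top_of_le_ne_top hsum (ENNReal.tsum_le_tsum fun k => le_self_add)
  have hp : ∑' k, lebModular (leb₂ Ω) p (gagQuot s p (w k) - gagQuot s p v) ≠ ∞ := by
    refine ne_top_of_le_ne_top hsum (ENNReal.tsum_le_tsum fun k => ?_)
    rw [H.modular_eq, map_sub]
    exact le_add_self
  have hlim : ∀ᵐ x ∂(leb Ω), Tendsto (fun k => w k x) atTop (𝓝 (v x)) := by
    filter_upwards [H.ae_eventually_le hd hl] with x hx
    rw [tendsto_iff_norm_sub_tendsto_zero]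
    exact squeeze_zero' (Eventually.of_forall fun k => norm_nonneg _) hx
      (tendsto_pow_atTop_nhds_zero_of_lt_one (by norm_num) (by norm_num))
  have hwa : ∀ k, AEMeasurable (fun x => |w k x|) (leb Ω) := fun k => (H.abs_mem_dom (hw k)).1
  have hva : AEMeasurable (fun x => |v x|) (leb Ω) := (H.abs_mem_dom hv).1
  -- Absolute values and their difference quotients are dominated by those of the original
  -- functions, so dominated convergence applies to each part of the modular.
  have t1 := tendsto_lebModular_sub H.one_lt H.qm H.qb (fun k => (hw k).1) hv.1 hwa hva hq
    (H.dom_le_domQ s hv).2.ne (fun k x => (abs_abs _).le) (fun x => (abs_abs _).le)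
    (hlim.mono fun x hx => hx.abs)
  have t2 := tendsto_lebModular_sub H.one_lt H.pm H.pb
    (fun k => H.aemeasurable_gagQuot s (hw k).1) (H.aemeasurable_gagQuot s hv.1)
    (fun k => H.aemeasurable_gagQuot s (hwa k)) (H.aemeasurable_gagQuot s hva) hp
    (H.gagQuot_mem_dom s hv).2.ne (fun k z => abs_gagQuot_abs_le s p _ z)
    (fun z => abs_gagQuot_abs_le s p _ z) ?_
  · have := t1.add t2
    rw [add_zero] at this
    refine this.congr fun k => ?_
    rw [H.modular_eq, map_sub]
  · filter_upwards [ae_prod_of_ae hlim] with z hz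
    exact (hz.1.abs.sub hz.2.abs).div_const _

theorem exists_modularNorm_abs_sub_lt {w : ℕ → E n → ℝ} {v : E n → ℝ} (hw : ∀ k, w k ∈ H.dom s)
    (hv : v ∈ H.dom s) (hl : ∀ k, modularNorm Ω s q p (w k - v) ≤ (1 / 4) ^ k) {ε : ℝ}
    (hε : 0 < ε) : ∃ k, modularNorm Ω s q p ((fun x => |w k x|) - fun x => |v x|) < ε := by
  set t := min ε 1 / 2 with ht
  have ht0 : 0 < t := by positivity
  have ht1 : t < ε := by have := min_le_left ε 1; linarith
  have ht2 : t ≤ 1 := by have := min_le_right ε 1; linarith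
  have hpos : (0 : ℝ≥0∞) < ENNReal.ofReal (t ^ b) := ENNReal.ofReal_pos.2 (by positivity)
  obtain ⟨k, hk⟩ := ((H.tendsto_modular_abs_sub hw hv hl).eventually (ge_mem_nhds hpos)).exists
  refine ⟨k, lt_of_le_of_lt ?_ ht1⟩
  rw [modularNorm_eq_lux]
  exact (H.mod s).lux_le_of_le
    ((H.dom s).sub_mem (H.abs_mem_dom (hw k)) (H.abs_mem_dom hv)).1 ht0 ht2 hk

end Bounds

/-! ### The space $\widetilde{\mathcal W}(\Omega)$, relative capacity and quasicontinuity -/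

namespace IsContCompact

variable {Ω : Set (E n)} {u v : E n → ℝ}

theorem zero : IsContCompact Ω (0 : E n → ℝ) :=
  ⟨continuousOn_const, ∅, isCompact_empty, empty_subset _, fun _ _ => rfl⟩

theorem add (hu : IsContCompact Ω u) (hv : IsContCompact Ω v) : IsContCompact Ω (u + v) := by
  obtain ⟨hu, K, hK, hKs, hK0⟩ := hu
  obtain ⟨hv, L, hL, hLs, hL0⟩ := hv
  refine ⟨hu.add hv, K ∪ L, hK.union hL, union_subset hKs hLs, fun x hx => ?_⟩
  rw [Pi.add_apply, hK0 x ⟨hx.1, fun h => hx.2 (Or.inl h)⟩,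
    hL0 x ⟨hx.1, fun h => hx.2 (Or.inr h)⟩, add_zero]

theorem smul (hu : IsContCompact Ω u) (c : ℝ) : IsContCompact Ω (c • u) := by
  obtain ⟨hu, K, hK, hKs, hK0⟩ := hu
  refine ⟨hu.const_smul c, K, hK, hKs, fun x hx => ?_⟩
  rw [Pi.smul_apply, hK0 x hx, smul_zero]

theorem abs (hu : IsContCompact Ω u) : IsContCompact Ω fun x => |u x| := by
  obtain ⟨hu, K, hK, hKs, hK0⟩ := hu
  refine ⟨hu.abs, K, hK, hKs, fun x hx => ?_⟩
  simp only [hK0 x hx, abs_zero]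

end IsContCompact

/-- The set `O` is small, in the sense of the norm: some nonnegative `u` in `W̃` with `u ≥ 1` on `O`
has norm less than `ε`. -/
def NormSmall (Ω : Set (E n)) (s : ℝ) (q : E n → ℝ) (p : E n × E n → ℝ) (O : Set (E n))
    (ε : ℝ) : Prop :=
  ∃ u : E n → ℝ, MemWTilde Ω s q p u ∧ (∀ᵐ x ∂(leb Ω), 0 ≤ u x) ∧
    (∀ᵐ x ∂(leb Ω), x ∈ O → 1 ≤ u x) ∧ modularNorm Ω s q p u < ε

theorem NormSmall.mono {Ω : Set (E n)} {s : ℝ} {q : E n → ℝ} {p : E n × E n → ℝ}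
    {O O' : Set (E n)} {ε ε' : ℝ} (h : NormSmall Ω s q p O ε) (hO : O' ⊆ O) (hε : ε ≤ ε') :
    NormSmall Ω s q p O' ε' := by
  obtain ⟨u, h1, h2, h3, h4⟩ := h
  exact ⟨u, h1, h2, h3.mono fun x hx hxO => hx (hO hxO), h4.trans_le hε⟩

namespace IsRelOpen

variable {Ω : Set (E n)}

theorem iUnion {ι : Sort*} {O : ι → Set (E n)} (h : ∀ k, IsRelOpen Ω (O k)) :
    IsRelOpen Ω (⋃ k, O k) := by
  choose U hU hO using h
  exact ⟨⋃ k, U k, isOpen_iUnion hU, by rw [iUnion_inter]; exact iUnion_congr hO⟩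

theorem union {O O' : Set (E n)} (h : IsRelOpen Ω O) (h' : IsRelOpen Ω O') :
    IsRelOpen Ω (O ∪ O') := by
  obtain ⟨U, hU, rfl⟩ := h
  obtain ⟨U', hU', rfl⟩ := h'
  exact ⟨U ∪ U', hU.union hU', (union_inter_distrib_right _ _ _).symm⟩

end IsRelOpen

/-- The pointwise limit of a sequence of functions, `0` where there is none. -/
def pointLim (w : ℕ → E n → ℝ) (x : E n) : ℝ :=
  open Classical in if h : ∃ l, Tendsto (fun k => w k x) atTop (𝓝 l) then h.choose else 0

theorem tendsto_pointLim {w : ℕ → E n → ℝ} {x : E n}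
    (h : ∃ l, Tendsto (fun k => w k x) atTop (𝓝 l)) :
    Tendsto (fun k => w k x) atTop (𝓝 (pointLim w x)) := by
  rw [pointLim, dif_pos h]
  exact h.choose_spec

namespace Bounds

variable {Ω : Set (E n)} {q : E n → ℝ} {p : E n × E n → ℝ} {a b : ℝ} (H : Bounds Ω q p a b)
  {s : ℝ}
include H

theorem memWTilde_iff {u : E n → ℝ} : MemWTilde Ω s q p u ↔ u ∈ H.dom s ∧ ∀ ε : ℝ, 0 < ε →
    ∃ v ∈ H.dom s, IsContCompact Ω v ∧ modularNorm Ω s q p (u - v) < ε := by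
  simp only [MemWTilde, H.memW_iff]
  refine and_congr_right fun hu => ⟨fun h ε hε => ?_, fun h ε hε => ?_⟩
  · obtain ⟨v, hv, hc, hlt⟩ := h ε hε
    exact ⟨v, hv, hc, (H.modularNorm_le_sumNorm ((H.dom s).sub_mem hu hv)).trans_lt hlt⟩
  · obtain ⟨v, hv, hc, hlt⟩ := h (ε / 2) (by positivity)
    refine ⟨v, hv, hc, (H.sumNorm_le_modularNorm ((H.dom s).sub_mem hu hv)).trans_lt ?_⟩
    linarith

theorem memWTilde_of_closure {u : E n → ℝ} (hu : u ∈ H.dom s)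
    (h : ∀ ε : ℝ, 0 < ε → ∃ v, MemWTilde Ω s q p v ∧ modularNorm Ω s q p (u - v) < ε) :
    MemWTilde Ω s q p u := by
  refine H.memWTilde_iff.2 ⟨hu, fun ε hε => ?_⟩
  obtain ⟨v, hv, hlt⟩ := h (ε / 2) (by positivity)
  obtain ⟨hvd, hv⟩ := H.memWTilde_iff.1 hv
  obtain ⟨w, hw, hc, hlt'⟩ := hv (ε / 2) (by positivity)
  refine ⟨w, hw, hc, ?_⟩
  linarith [H.modularNorm_sub_le hu hvd hw]

/-- The space `W̃^{s,q(.),p(.,.)}(Ω)`. -/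
def wTilde (H : Bounds Ω q p a b) (s : ℝ) : Submodule ℝ (E n → ℝ) where
  carrier := {u | MemWTilde Ω s q p u}
  zero_mem' := H.memWTilde_iff.2 ⟨(H.dom s).zero_mem, fun ε hε =>
    ⟨0, (H.dom s).zero_mem, IsContCompact.zero, by
      rw [sub_zero, modularNorm_eq_lux, (H.mod s).lux_zero]; exact hε⟩⟩
  add_mem' := by
    intro u v hu hv
    obtain ⟨hu, hu'⟩ := H.memWTilde_iff.1 hu
    obtain ⟨hv, hv'⟩ := H.memWTilde_iff.1 hv
    refine H.memWTilde_iff.2 ⟨(H.dom s).add_mem hu hv, fun ε hε => ?_⟩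
    obtain ⟨f, hf, hfc, hfl⟩ := hu' (ε / 2) (by positivity)
    obtain ⟨g, hg, hgc, hgl⟩ := hv' (ε / 2) (by positivity)
    refine ⟨f + g, (H.dom s).add_mem hf hg, hfc.add hgc, ?_⟩
    rw [add_sub_add_comm]
    linarith [H.modularNorm_add_le ((H.dom s).sub_mem hu hf) ((H.dom s).sub_mem hv hg)]
  smul_mem' := by
    intro c u hu
    obtain ⟨hu, hu'⟩ := H.memWTilde_iff.1 hu
    refine H.memWTilde_iff.2 ⟨(H.dom s).smul_mem c hu, fun ε hε => ?_⟩
    obtain ⟨f, hf, hfc, hfl⟩ := hu' (ε / (|c| + 1)) (by positivity)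
    refine ⟨c • f, (H.dom s).smul_mem c hf, hfc.smul c, ?_⟩
    rw [← smul_sub, H.modularNorm_smul ((H.dom s).sub_mem hu hf)]
    rw [lt_div_iff₀ (by positivity)] at hfl
    nlinarith [modularNorm_nonneg Ω s q p (u - f)]

theorem wTilde_le : H.wTilde s ≤ H.dom s := fun _ hu => (H.memWTilde_iff.1 hu).1

/-- Continuous approximants `v k` are chosen to converge rapidly to `u`. Dominated convergence makes
the absolute values of `v k` approximate that of `u`, and they are again continuous with compact
support. -/
theorem memWTilde_abs {u : E n → ℝ} (hu : MemWTilde Ω s q p u) :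
    MemWTilde Ω s q p fun x => |u x| := by
  obtain ⟨hu, hu'⟩ := H.memWTilde_iff.1 hu
  choose v hv hvc hvl using fun k : ℕ => hu' ((1 / 4) ^ k) (by positivity)
  refine H.memWTilde_iff.2 ⟨H.abs_mem_dom hu, fun ε hε => ?_⟩
  obtain ⟨k, hk⟩ := H.exists_modularNorm_abs_sub_lt hv hu
    (fun k => by rw [H.modularNorm_sub_comm]; exact (hvl k).le) hε
  exact ⟨_, H.abs_mem_dom (hv k), (hvc k).abs, by rwa [H.modularNorm_sub_comm]⟩

theorem memWTilde_sup {u v : E n → ℝ} (hu : MemWTilde Ω s q p u) (hv : MemWTilde Ω s q p v) :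
    MemWTilde Ω s q p (u ⊔ v) := by
  have h1 : MemWTilde Ω s q p fun x => |(u - v) x| :=
    H.memWTilde_abs ((H.wTilde s).sub_mem hu hv)
  have h2 := (H.wTilde s).smul_mem (1 / 2)
    ((H.wTilde s).add_mem ((H.wTilde s).add_mem hu hv) h1)
  have h3 : u ⊔ v = (1 / 2 : ℝ) • (u + v + fun x => |(u - v) x|) := by
    funext x
    simp only [Pi.sup_apply, Pi.smul_apply, Pi.add_apply, Pi.sub_apply, smul_eq_mul]
    rcases le_total (u x) (v x) with h | h
    · rw [sup_eq_right.2 h, abs_of_nonpos (sub_nonpos.2 h)]; ring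
    · rw [sup_eq_left.2 h, abs_of_nonneg (sub_nonneg.2 h)]; ring
  rw [h3]
  exact h2

/-- A competitor of modular below `t ^ b` has norm at most `t`, and taking its absolute value makes
it nonnegative without increasing the norm. With the converse `capacity_le_of_normSmall`, capacity
may be replaced by the subadditive notion `NormSmall`. -/
theorem exists_normSmall_of_capacity_lt {ε : ℝ} (hε : 0 < ε) : ∃ δ : ℝ≥0∞, 0 < δ ∧
    ∀ A : Set (E n), capacity Ω s q p A < δ →
      ∃ O, IsRelOpen Ω O ∧ A ⊆ O ∧ NormSmall Ω s q p O ε := by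
  set t := min ε 1 / 2 with ht
  have ht0 : 0 < t := by positivity
  have ht1 : t < ε := by have := min_le_left ε 1; linarith
  have ht2 : t ≤ 1 := by have := min_le_right ε 1; linarith
  refine ⟨ENNReal.ofReal (t ^ b), ENNReal.ofReal_pos.2 (by positivity), fun A hA => ?_⟩
  simp only [capacity, openCapacity, iInf_lt_iff] at hA
  obtain ⟨O, ⟨hO, hAO⟩, u, ⟨hu, hu1⟩, hlt⟩ := hA
  refine ⟨O, hO, hAO, fun x => |u x|, H.memWTilde_abs hu,
    Eventually.of_forall fun x => abs_nonneg _,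
    hu1.mono fun x hx hxO => (hx hxO).trans (le_abs_self _), ?_⟩
  have hud := H.wTilde_le hu
  refine (H.modularNorm_abs_le hud).trans_lt (lt_of_le_of_lt ?_ ht1)
  rw [modularNorm_eq_lux]
  exact (H.mod s).lux_le_of_le hud.1 ht0 ht2 hlt.le

theorem capacity_le_of_normSmall {A O : Set (E n)} {ε : ℝ} (hO : IsRelOpen Ω O) (hA : A ⊆ O)
    (h0 : 0 < ε) (h1 : ε ≤ 1) (h : NormSmall Ω s q p O ε) :
    capacity Ω s q p A ≤ ENNReal.ofReal ε := by
  obtain ⟨u, hu, -, hu1, hlt⟩ := h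
  refine (iInf₂_le O ⟨hO, hA⟩).trans ((iInf₂_le u ⟨hu, hu1⟩).trans ?_)
  refine (H.mod s).le_of_lux_le (H.wTilde_le hu) h0 h1 ?_
  rw [← modularNorm_eq_lux]
  exact hlt.le

theorem normSmall_union {O O' : Set (E n)} {ε ε' : ℝ} (h : NormSmall Ω s q p O ε)
    (h' : NormSmall Ω s q p O' ε') : NormSmall Ω s q p (O ∪ O') (ε + ε') := by
  obtain ⟨u, hu, hu0, hu1, hul⟩ := h
  obtain ⟨v, hv, hv0, hv1, hvl⟩ := h'
  refine ⟨u + v, (H.wTilde s).add_mem hu hv, ?_, ?_,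
    (H.modularNorm_add_le (H.wTilde_le hu) (H.wTilde_le hv)).trans_lt (add_lt_add hul hvl)⟩
  · filter_upwards [hu0, hv0] with x h1 h2 using add_nonneg h1 h2
  · filter_upwards [hu0, hv0, hu1, hv1] with x h1 h2 h3 h4 hx
    rw [Pi.add_apply]
    rcases hx with hx | hx
    · linarith [h3 hx]
    · linarith [h4 hx]

/-- The sum of the competitors serves the union: since all are nonnegative, the limit of the partial
sums dominates each of them. It stays in $\widetilde{\mathcal W}$ because the partial sums converge
in norm. -/
theorem normSmall_iUnion {O : ℕ → Set (E n)} {ε : ℝ} (h0 : 0 < ε) (h1 : ε ≤ 1)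
    (h : ∀ k, NormSmall Ω s q p (O k) (ε * (1 / 4) ^ (k + 1))) :
    NormSmall Ω s q p (⋃ k, O k) ε := by
  choose u hu hu0 hu1 hul using h
  set S : ℕ → E n → ℝ := fun k => ∑ i ∈ Finset.range k, u i with hS
  have hSW : ∀ k, MemWTilde Ω s q p (S k) := fun k => (H.wTilde s).sum_mem fun i _ => hu i
  have hSd : ∀ k, S k ∈ H.dom s := fun k => H.wTilde_le (hSW k)
  have hinc : ∀ k, modularNorm Ω s q p (S (k + 1) - S k) ≤ (1 / 4) ^ k := by
    intro k
    have e : S (k + 1) - S k = u k := by simp [hS, Finset.sum_range_succ]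
    rw [e]
    refine (hul k).le.trans ?_
    have : (0 : ℝ) < (1 / 4) ^ k := by positivity
    rw [pow_succ]
    nlinarith
  have hlim : ∀ᵐ x ∂(leb Ω), Tendsto (fun k => S k x) atTop (𝓝 (pointLim S x)) :=
    (H.ae_exists_tendsto hSd hinc).mono fun x hx => tendsto_pointLim hx
  obtain ⟨hvd, hvl⟩ := H.limit_mem_dom hSd hinc hlim
  have hSle : ∀ᵐ x ∂(leb Ω), ∀ i, u i x ≤ pointLim S x ∧ 0 ≤ u i x := by
    filter_upwards [hlim, ae_all_iff.2 hu0] with x hx h0x i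
    refine ⟨ge_of_tendsto hx ?_, h0x i⟩
    filter_upwards [eventually_gt_atTop i] with k hk
    simp only [hS, Finset.sum_apply]
    exact Finset.single_le_sum (f := fun i => u i x) (fun j _ => h0x j) (Finset.mem_range.2 hk)
  refine ⟨pointLim S, H.memWTilde_of_closure hvd fun η hη => ?_, ?_, ?_, ?_⟩
  · obtain ⟨k, hk⟩ := exists_pow_lt_of_lt_one (show 0 < η / 2 by positivity)
      (show (1 / 4 : ℝ) < 1 by norm_num)
    exact ⟨S k, hSW k, by linarith [hvl k]⟩
  · filter_upwards [hSle] with x hx using (hx 0).2.trans (hx 0).1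
  · filter_upwards [hSle, ae_all_iff.2 hu1] with x hx h1x hxO
    obtain ⟨k, hk⟩ := mem_iUnion.1 hxO
    exact (h1x k hk).trans (hx k).1
  -- The norms sum to at most `ε / 3`; the bound `ε / 2` leaves slack for an induction and keeps the
  -- final inequality strict after Fatou's lemma.
  · have hb : ∀ k, modularNorm Ω s q p (S k) ≤ ε / 2 - ε / 2 * (1 / 4) ^ k := by
      intro k
      induction k with
      | zero =>
        have : S 0 = 0 := by simp [hS]
        rw [this, modularNorm_eq_lux, (H.mod s).lux_zero]; simp
      | succ k ih =>
        have e : S (k + 1) = S k + u k := by simp [hS, Finset.sum_range_succ]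
        rw [e]
        have := H.modularNorm_add_le (hSd k) (H.wTilde_le (hu k))
        have h2 := hul k
        rw [pow_succ] at h2 ⊢
        have h3 : (0 : ℝ) < ε * (1 / 4) ^ k := by positivity
        linarith
    refine (H.modularNorm_le_of_tendsto_ae (t := ε / 2) (by positivity) hSd (fun k => ?_)
      hlim).trans_lt (by linarith)
    have : (0 : ℝ) < ε / 2 * (1 / 4) ^ k := by positivity
    linarith [hb k]

theorem isQuasicontinuous_iff {w : E n → ℝ} : IsQuasicontinuous Ω s q p w ↔
    ∀ ε : ℝ, 0 < ε → ∃ O, IsRelOpen Ω O ∧ NormSmall Ω s q p O ε ∧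
      ContinuousOn w (closure Ω \ O) := by
  constructor
  · intro h ε hε
    obtain ⟨δ, hδ, hcap⟩ := H.exists_normSmall_of_capacity_lt (s := s) hε
    obtain ⟨O, hO, hOc, hw⟩ := h δ hδ
    obtain ⟨O', hO', hOO', hs⟩ := hcap O hOc
    exact ⟨O', hO', hs, hw.mono (sdiff_subset_sdiff_right hOO')⟩
  · intro h ε hε
    obtain ⟨t, ht0, ht⟩ := ENNReal.lt_iff_exists_nnreal_btwn.1 hε
    have ht0' : (0 : ℝ) < t := by exact_mod_cast ht0
    obtain ⟨O, hO, hs, hw⟩ := h (min t 1) (by positivity)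
    refine ⟨O, hO, ?_, hw⟩
    refine (H.capacity_le_of_normSmall hO subset_rfl (by positivity) (min_le_right _ _) hs).trans_lt
      (lt_of_le_of_lt (ENNReal.ofReal_le_ofReal (min_le_left _ _)) ?_)
    simpa using ht

/-- A weak type estimate for quasicontinuous functions. -/
theorem exists_normSmall_abs_le {w : E n → ℝ} (hq : IsQuasicontinuous Ω s q p w)
    (hw : MemWTilde Ω s q p w) {t ε : ℝ} (ht : 0 < t) (hlt : modularNorm Ω s q p w < t * ε) :
    ∃ O, IsRelOpen Ω O ∧ NormSmall Ω s q p O ε ∧ ∀ x ∈ closure Ω \ O, |w x| ≤ t := by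
  have hva := H.memWTilde_abs hw
  have hv : MemWTilde Ω s q p (t⁻¹ • fun x => |w x|) := (H.wTilde s).smul_mem t⁻¹ hva
  have hvn : modularNorm Ω s q p (t⁻¹ • fun x => |w x|) < ε := by
    rw [H.modularNorm_smul (H.wTilde_le hva), abs_of_pos (inv_pos.2 ht), inv_mul_lt_iff₀ ht]
    exact (H.modularNorm_abs_le (H.wTilde_le hw)).trans_lt hlt
  -- The set where `|w| > t` need not be relatively open, but it becomes so after uniting it with
  -- `P`, off which `w` is continuous. `P` is chosen to fit into the slack between `ε` and the norm
  -- of `|w| / t`; the competitor is `g + |w| / t`.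
  obtain ⟨P, hP, ⟨g, hg, hg0, hg1, hgl⟩, hc⟩ := H.isQuasicontinuous_iff.1 hq _ (sub_pos.2 hvn)
  obtain ⟨U, hU, hUeq⟩ := continuousOn_iff'.1 hc.abs (Ioi t) isOpen_Ioi
  refine ⟨P ∪ U ∩ closure Ω, hP.union ⟨U, hU, rfl⟩, ⟨g + t⁻¹ • fun x => |w x|,
    (H.wTilde s).add_mem hg hv, ?_, ?_, ?_⟩, ?_⟩
  · filter_upwards [hg0] with x hx
    simp only [Pi.add_apply, Pi.smul_apply, smul_eq_mul]
    positivity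
  · filter_upwards [hg0, hg1] with x h0 h1 hx
    simp only [Pi.add_apply, Pi.smul_apply, smul_eq_mul]
    have hnn : 0 ≤ t⁻¹ * |w x| := by positivity
    by_cases hxP : x ∈ P
    · linarith [h1 hxP]
    · have hxU := hx.resolve_left hxP
      have hx2 : x ∈ U ∩ (closure Ω \ P) := ⟨hxU.1, hxU.2, hxP⟩
      rw [← hUeq] at hx2
      have : 1 ≤ t⁻¹ * |w x| := by
        rw [le_inv_mul_iff₀ ht, mul_one]; exact (mem_Ioi.1 hx2.1).le
      linarith
  · have := H.modularNorm_add_le (H.wTilde_le hg) (H.wTilde_le hv)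
    linarith
  · rintro x ⟨hx, hxn⟩
    by_contra! hcon
    have hxP : x ∉ P := fun h => hxn (Or.inl h)
    have hx2 : x ∈ (fun x => |w x|) ⁻¹' Ioi t ∩ (closure Ω \ P) := ⟨hcon, hx, hxP⟩
    rw [hUeq] at hx2
    exact hxn (Or.inr ⟨hx2.1, hx⟩)

theorem isQuasicontinuous_comp₂ {F : ℝ → ℝ → ℝ} (hF : Continuous (Function.uncurry F))
    {v w : E n → ℝ} (hv : IsQuasicontinuous Ω s q p v) (hw : IsQuasicontinuous Ω s q p w) :
    IsQuasicontinuous Ω s q p fun x => F (v x) (w x) := by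
  rw [H.isQuasicontinuous_iff] at hv hw ⊢
  intro ε hε
  obtain ⟨O, hO, hOs, hOc⟩ := hv (ε / 2) (by positivity)
  obtain ⟨P, hP, hPs, hPc⟩ := hw (ε / 2) (by positivity)
  refine ⟨O ∪ P, hO.union hP, (H.normSmall_union hOs hPs).mono subset_rfl (by linarith), ?_⟩
  exact hF.comp_continuousOn ((hOc.mono (sdiff_subset_sdiff_right subset_union_left)).prodMk
    (hPc.mono (sdiff_subset_sdiff_right subset_union_right)))

theorem capacity_iUnion_eq_zero {P : ℕ → Set (E n)} (h : ∀ k, capacity Ω s q p (P k) = 0) :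
    capacity Ω s q p (⋃ k, P k) = 0 := by
  have key : ∀ ε : ℝ, 0 < ε → ε ≤ 1 → capacity Ω s q p (⋃ k, P k) ≤ ENNReal.ofReal ε := by
    intro ε h0 h1
    have : ∀ k, ∃ O, IsRelOpen Ω O ∧ P k ⊆ O ∧ NormSmall Ω s q p O (ε * (1 / 4) ^ (k + 1)) := by
      intro k
      obtain ⟨δ, hδ, hcap⟩ := H.exists_normSmall_of_capacity_lt (s := s)
        (show 0 < ε * (1 / 4) ^ (k + 1) by positivity)
      exact hcap (P k) (by rw [h k]; exact hδ)
    choose O hO hPO hs using this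
    exact H.capacity_le_of_normSmall (IsRelOpen.iUnion hO) (iUnion_mono hPO) h0 h1
      (H.normSmall_iUnion h0 h1 hs)
  refine le_antisymm (le_of_forall_gt_imp_ge_of_dense fun ε hε => ?_) zero_le
  obtain ⟨t, ht0, ht⟩ := ENNReal.lt_iff_exists_nnreal_btwn.1 hε
  have ht0' : (0 : ℝ) < t := by exact_mod_cast ht0
  refine (key (min t 1) (by positivity) (min_le_right _ _)).trans
    ((ENNReal.ofReal_le_ofReal (min_le_left _ _)).trans ?_)
  simpa using ht.le

theorem isZeroOutside_comp₂ {F : ℝ → ℝ → ℝ} (hF : F 0 0 = 0)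
    {v w : E n → ℝ} (hv : IsZeroOutside Ω s q p v) (hw : IsZeroOutside Ω s q p w) :
    IsZeroOutside Ω s q p fun x => F (v x) (w x) := by
  obtain ⟨P, hP, hPc, hP0⟩ := hv
  obtain ⟨Q, hQ, hQc, hQ0⟩ := hw
  -- The union of two sets is written as a countable union, to which countable subadditivity
  -- applies.
  set R : ℕ → Set (E n) := fun k => if k = 0 then P else Q
  have hR : ⋃ k, R k = P ∪ Q := by
    ext x
    simp only [mem_iUnion, mem_union, R]
    constructor
    · rintro ⟨k, hk⟩
      split_ifs at hk
      exacts [Or.inl hk, Or.inr hk]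
    · rintro (h | h)
      exacts [⟨0, by simpa using h⟩, ⟨1, by simpa using h⟩]
  refine ⟨P ∪ Q, union_subset hP hQ, ?_, fun x hx => ?_⟩
  · rw [← hR]
    refine H.capacity_iUnion_eq_zero fun k => ?_
    simp only [R]; split_ifs <;> assumption
  · simp only
    rw [hP0 x ⟨hx.1, fun h => hx.2 (Or.inl h)⟩, hQ0 x ⟨hx.1, fun h => hx.2 (Or.inr h)⟩, hF]

/-- The limit of a rapid Cauchy sequence of quasicontinuous functions that vanish outside. -/
theorem exists_limit_zeroTrace {w : ℕ → E n → ℝ} (hq : ∀ k, IsQuasicontinuous Ω s q p (w k))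
    (hw : ∀ k, MemWTilde Ω s q p (w k)) (hz : ∀ k, IsZeroOutside Ω s q p (w k))
    (hl : ∀ k, modularNorm Ω s q p (w (k + 1) - w k) < (1 / 64) ^ (k + 1)) :
    ∃ v, IsQuasicontinuous Ω s q p v ∧ MemWTilde Ω s q p v ∧ IsZeroOutside Ω s q p v ∧
      ∀ k, modularNorm Ω s q p (v - w k) ≤ 2 * (1 / 4) ^ k := by
  have hwd : ∀ k, w k ∈ H.dom s := fun k => H.wTilde_le (hw k)
  have hl4 : ∀ k, modularNorm Ω s q p (w (k + 1) - w k) ≤ (1 / 4) ^ k := fun k =>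
    (hl k).le.trans (calc
      (1 / 64 : ℝ) ^ (k + 1) ≤ (1 / 64) ^ k :=
        pow_le_pow_of_le_one (by norm_num) (by norm_num) (Nat.le_succ k)
      _ ≤ (1 / 4) ^ k := by gcongr; norm_num)
  obtain ⟨hvd, hvl⟩ := H.limit_mem_dom hwd hl4
    ((H.ae_exists_tendsto hwd hl4).mono fun x hx => tendsto_pointLim hx)
  -- The limit is taken at every point where it exists: a limit a.e. in `Ω` would not determine the
  -- values on the boundary.
  refine ⟨pointLim w, ?_, H.memWTilde_of_closure hvd fun η hη => ?_, ?_, hvl⟩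
  -- The rate `64` splits as `4 * 16`: the differences are at most `4⁻⁽ᵏ⁺¹⁾` off sets of size
  -- `16⁻⁽ᵏ⁺¹⁾`. The sets `B k` carry the discontinuities of the individual functions.
  · have hA : ∀ k, ∃ O, IsRelOpen Ω O ∧ NormSmall Ω s q p O ((1 / 16) ^ (k + 1)) ∧
        ∀ x ∈ closure Ω \ O, |(w (k + 1) - w k) x| ≤ (1 / 4) ^ (k + 1) := fun k =>
      H.exists_normSmall_abs_le
        (H.isQuasicontinuous_comp₂ (F := fun x y => x - y)
          (continuous_fst.sub continuous_snd) (hq (k + 1)) (hq k))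
        ((H.wTilde s).sub_mem (hw (k + 1)) (hw k)) (by positivity) (by
          have := hl k
          rw [← mul_pow]; norm_num at this ⊢; exact this)
    choose A hAo hAs hAle using hA
    choose B hBo hBs hBc using fun k => H.isQuasicontinuous_iff.1 (hq k) ((1 / 16) ^ (k + 1))
      (by positivity)
    rw [H.isQuasicontinuous_iff]
    intro ε hε
    obtain ⟨m, hm⟩ := exists_pow_lt_of_lt_one (show 0 < min ε 1 / 2 by positivity)
      (show (1 / 16 : ℝ) < 1 by norm_num)
    have hm1 : 2 * (1 / 16 : ℝ) ^ m ≤ ε := by have := min_le_left ε 1; linarith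
    have hm2 : 2 * (1 / 16 : ℝ) ^ m ≤ 1 := by have := min_le_right ε 1; linarith
    refine ⟨⋃ j, (A (m + j) ∪ B (m + j)), IsRelOpen.iUnion fun j => (hAo _).union (hBo _),
      (H.normSmall_iUnion (by positivity) hm2 fun j => ?_).mono subset_rfl hm1, ?_⟩
    · refine (H.normSmall_union (hAs (m + j)) (hBs (m + j))).mono subset_rfl ?_
      have h1 : (1 / 16 : ℝ) ^ (j + 1) ≤ (1 / 4) ^ (j + 1) := by gcongr; norm_num
      have h2 : (0 : ℝ) < (1 / 16) ^ m := by positivity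
      rw [add_assoc, pow_add]
      nlinarith
    -- Off `G` the tail of the sequence is continuous and converges uniformly, at a geometric rate.
    · set G := ⋃ j, (A (m + j) ∪ B (m + j))
      have hxA : ∀ x ∈ closure Ω \ G, ∀ j, x ∈ closure Ω \ A (m + j) := fun x hx j =>
        ⟨hx.1, fun h => hx.2 (mem_iUnion.2 ⟨j, Or.inl h⟩)⟩
      have hstep : ∀ x ∈ closure Ω \ G, ∀ j,
          dist (w (j + m) x) (w (j + 1 + m) x) ≤ 1 * (1 / 4) ^ j := by
        intro x hx j
        have h1 := hAle (m + j) x (hxA x hx j)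
        rw [dist_comm, Real.dist_eq, add_right_comm, add_comm j m, one_mul]
        refine h1.trans (pow_le_pow_of_le_one (by norm_num) (by norm_num) (by omega))
      have hconv : ∀ x ∈ closure Ω \ G, Tendsto (fun j => w (j + m) x) atTop
          (𝓝 (pointLim w x)) := by
        intro x hx
        obtain ⟨l, hlx⟩ := cauchySeq_tendsto_of_complete
          (cauchySeq_of_le_geometric (1 / 4) 1 (by norm_num) (hstep x hx))
        exact (tendsto_add_atTop_iff_nat (f := fun k => w k x) m).2
          (tendsto_pointLim ⟨l, (tendsto_add_atTop_iff_nat m).1 hlx⟩)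
      have hunif : TendstoUniformlyOn (fun j => w (j + m)) (pointLim w) atTop (closure Ω \ G) := by
        rw [Metric.tendstoUniformlyOn_iff]
        intro η hη
        obtain ⟨J, hJ⟩ := exists_pow_lt_of_lt_one (show 0 < η / 2 by positivity)
          (show (1 / 4 : ℝ) < 1 by norm_num)
        filter_upwards [eventually_ge_atTop J] with j hj x hx
        have h1 := dist_le_of_le_geometric_of_tendsto (1 / 4) 1 (by norm_num) (hstep x hx)
          (hconv x hx) j
        have h2 : (1 / 4 : ℝ) ^ j ≤ (1 / 4) ^ J :=
          pow_le_pow_of_le_one (by norm_num) (by norm_num) hj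
        rw [dist_comm]
        refine h1.trans_lt ?_
        rw [div_lt_iff₀ (by norm_num)]
        linarith
      refine hunif.continuousOn (Frequently.of_forall fun j => (hBc (j + m)).mono ?_)
      rintro x ⟨hx, hxG⟩
      exact ⟨hx, fun h => hxG (mem_iUnion.2 ⟨j, Or.inr (by rwa [add_comm m j])⟩)⟩
  · obtain ⟨k, hk⟩ := exists_pow_lt_of_lt_one (show 0 < η / 2 by positivity)
      (show (1 / 4 : ℝ) < 1 by norm_num)
    exact ⟨w k, hw k, by linarith [hvl k]⟩
  -- Off the union of the exceptional sets the whole sequence vanishes, so its pointwise limit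
  -- exists there and is `0`.
  · choose P hP hPc hP0 using hz
    refine ⟨⋃ k, P k, iUnion_subset hP, H.capacity_iUnion_eq_zero hPc, fun x hx => ?_⟩
    have h0 : ∀ k, w k x = 0 := fun k => hP0 k x ⟨hx.1, fun h => hx.2 (mem_iUnion.2 ⟨k, h⟩)⟩
    have h1 : Tendsto (fun k => w k x) atTop (𝓝 0) := by
      simp only [h0]; exact tendsto_const_nhds
    exact tendsto_nhds_unique (tendsto_pointLim ⟨0, h1⟩) h1

end Bounds

/-! ### Criteria for the Banach space properties of a normed subspace -/

section Banach

variable {V : Type*} [AddCommGroup V] [Module ℝ V] {S : Submodule ℝ V} {N N' : V → ℝ}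

theorem normedSpaceCore_normedBy (h0 : ∀ u ∈ S, 0 ≤ N u)
    (hs : ∀ u ∈ S, ∀ c : ℝ, N (c • u) = |c| * N u)
    (ht : ∀ u ∈ S, ∀ v ∈ S, N (u + v) ≤ N u + N v) (hz : ∀ u ∈ S, N u = 0 → u = 0) :
    NormedSpace.Core ℝ (NormedBy S N) where
  norm_nonneg x := h0 _ x.2
  norm_smul c x := hs _ x.2 c
  norm_triangle x y := ht _ x.2 _ y.2
  norm_eq_zero_iff x := by
    refine ⟨fun h => Subtype.ext (hz _ x.2 h), ?_⟩
    rintro rfl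
    have := hs 0 S.zero_mem 0
    rw [abs_zero, zero_mul, zero_smul] at this
    exact this

theorem completeSpace_normedBy (h : NormedSpace.Core ℝ (NormedBy S N))
    (hc : ∀ u : ℕ → V, (∀ k, u k ∈ S) → (∀ k, N (u (k + 1) - u k) < (1 / 64) ^ (k + 1)) →
      ∃ v ∈ S, Tendsto (fun k => N (u k - v)) atTop (𝓝 0)) :
    letI := NormedAddCommGroup.ofCore h
    CompleteSpace (NormedBy S N) := by
  let := NormedAddCommGroup.ofCore h
  refine Metric.complete_of_convergent_controlled_sequences (fun k => (1 / 64) ^ (k + 1))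
    (fun k => by positivity) fun u hu => ?_
  obtain ⟨v, hv, hlim⟩ := hc (fun k => (u k).1) (fun k => (u k).2) fun k => by
    have := hu k (k + 1) k (Nat.le_succ k) le_rfl
    rw [dist_eq_norm] at this
    exact this
  let v' : NormedBy S N := (⟨v, hv⟩ : S)
  exact ⟨v', tendsto_iff_norm_sub_tendsto_zero.2 hlim⟩

/-- The range of `Φ` is separable as a subset of a second countable space, and preimages of a
countable dense subset are dense because nearby images come from nearby points. Neither linearity
nor continuity of `Φ` is required. -/
theorem separableSpace_normedBy (h : NormedSpace.Core ℝ (NormedBy S N)) {Y : Type*}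
    [PseudoEMetricSpace Y] [SecondCountableTopology Y] (Φ : S → Y)
    (hΦ : ∀ ε : ℝ, 0 < ε → ∃ δ : ℝ≥0∞, 0 < δ ∧ ∀ x y : S, edist (Φ x) (Φ y) < δ →
      N (x.1 - y.1) < ε) :
    letI := NormedAddCommGroup.ofCore h
    TopologicalSpace.SeparableSpace (NormedBy S N) := by
  let := NormedAddCommGroup.ofCore h
  obtain ⟨D, hD, hDc⟩ := TopologicalSpace.exists_countable_dense (range Φ)
  choose g hg using fun y : range Φ => y.2
  refine ⟨g '' D, hD.image g, fun x => ?_⟩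
  refine Metric.mem_closure_iff.2 fun ε hε => ?_
  obtain ⟨δ, hδ, hlt⟩ := hΦ ε hε
  obtain ⟨y, hy, hxy⟩ := EMetric.mem_closure_iff.1 (hDc ⟨Φ x, mem_range_self _⟩) δ hδ
  let y' : NormedBy S N := g y
  refine ⟨y', mem_image_of_mem g hy, (dist_eq_norm x y').trans_lt ?_⟩
  exact hlt x (g y) (by rw [hg]; exact hxy)

theorem uniformConvexSpace_normedBy (h : NormedSpace.Core ℝ (NormedBy S N))
    (hu : ∀ ε : ℝ, 0 < ε → ∃ δ : ℝ, 0 < δ ∧ ∀ u ∈ S, ∀ v ∈ S, N u ≤ 1 → N v ≤ 1 →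
      ε ≤ N (u - v) → N (u + v) ≤ 2 - δ) :
    letI := NormedAddCommGroup.ofCore h
    UniformConvexSpace (NormedBy S N) := by
  let := NormedAddCommGroup.ofCore h
  refine ⟨fun ε hε => ?_⟩
  obtain ⟨δ, hδ, hlt⟩ := hu ε hε
  exact ⟨δ, hδ, fun x hx y hy hxy => hlt _ x.2 _ y.2 (le_of_eq hx) (le_of_eq hy) hxy⟩

theorem isSeparableReflexiveBanach_of_uniformConvex (h : NormedSpace.Core ℝ (NormedBy S N))
    (hc : letI := NormedAddCommGroup.ofCore h; CompleteSpace (NormedBy S N))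
    (hs : letI := NormedAddCommGroup.ofCore h; TopologicalSpace.SeparableSpace (NormedBy S N))
    (hu : letI := NormedAddCommGroup.ofCore h; UniformConvexSpace (NormedBy S N)) :
    IsSeparableReflexiveBanach S N := by
  let := NormedAddCommGroup.ofCore h
  let := NormedSpace.ofCore h
  refine ⟨h, hc, hs, ?_⟩
  have := hc
  have := hu
  exact surjective_inclusionInDoubleDual_of_uniformConvex

theorem IsSeparableReflexiveBanach.of_equivalent (hN : IsSeparableReflexiveBanach S N)
    (h' : NormedSpace.Core ℝ (NormedBy S N')) {C C' : ℝ}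
    (h1 : ∀ u ∈ S, N' u ≤ C * N u) (h2 : ∀ u ∈ S, N u ≤ C' * N' u) :
    IsSeparableReflexiveBanach S N' := by
  obtain ⟨h, hall⟩ := hN
  let i1 := NormedAddCommGroup.ofCore h
  let i2 := NormedSpace.ofCore h
  let i3 := NormedAddCommGroup.ofCore h'
  let i4 := NormedSpace.ofCore h'
  -- The identity of `S` is an isomorphism between the two norms, by the bounds `h1` and `h2`.
  let e₀ : NormedBy S N ≃ₗ[ℝ] NormedBy S N' := LinearEquiv.refl ℝ S
  exact ⟨h', separableReflexive_of_equiv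
    (e₀.toContinuousLinearEquivOfBounds C C' (fun x => h1 _ x.2) fun x => h2 _ x.2) hall⟩

end Banach

/-! ### Odd powers in $L^1$, and the zero trace space as a Banach space -/

theorem aemeasurable_signedPow {α : Type*} [MeasurableSpace α] {μ : Measure α} {r f : α → ℝ}
    (hr : AEMeasurable r μ) (hf : AEMeasurable f μ) :
    AEMeasurable (fun x => signedPow (r x) (f x)) μ := by
  have := hf.mul (hf.norm.pow (hr.sub_const 1))
  exact this

theorem memLp_signedPow {α : Type*} [MeasurableSpace α] {μ : Measure α} {r f : α → ℝ}
    (hr : AEMeasurable r μ) (hr0 : ∀ᵐ x ∂μ, 0 < r x) (hf : AEMeasurable f μ)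
    (hfin : lebModular μ r f < ∞) : MemLp (fun x => signedPow (r x) (f x)) 1 μ := by
  refine ⟨(aemeasurable_signedPow hr hf).aestronglyMeasurable, ?_⟩
  rw [eLpNorm_one_eq_lintegral_enorm]
  refine lt_of_le_of_lt (lintegral_mono_ae ?_) hfin
  filter_upwards [hr0] with x hx
  rw [Real.enorm_eq_ofReal_abs, abs_signedPow hx]

theorem lebModular_sub_le_eLpNorm {α : Type*} [MeasurableSpace α] {μ : Measure α} {r : α → ℝ}
    {b : ℝ} (hr : ∀ᵐ x ∂μ, 1 ≤ r x ∧ r x ≤ b) (f g : α → ℝ) :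
    lebModular μ r (f - g) ≤ ENNReal.ofReal (2 ^ b) *
      eLpNorm ((fun x => signedPow (r x) (f x)) - fun x => signedPow (r x) (g x)) 1 μ := by
  rw [eLpNorm_one_eq_lintegral_enorm, lebModular, ← lintegral_const_mul' _ _ ENNReal.ofReal_ne_top]
  refine lintegral_mono_ae ?_
  filter_upwards [hr] with x hx
  rw [Real.enorm_eq_ofReal_abs, ← ENNReal.ofReal_mul (by positivity)]
  refine ENNReal.ofReal_le_ofReal ((abs_sub_rpow_le_signedPow hx.1 _ _).trans ?_)
  exact mul_le_mul_of_nonneg_right (Real.rpow_le_rpow_of_exponent_le one_le_two hx.2)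
    (abs_nonneg _)

namespace Bounds

variable {Ω : Set (E n)} {q : E n → ℝ} {p : E n × E n → ℝ} {a b : ℝ} (H : Bounds Ω q p a b)
  {s : ℝ}
include H

/-- The common source of the linear and the lattice structure: `F` is taken to be addition, a scalar
multiple, the maximum or the minimum. Only membership in $\widetilde{\mathcal W}$ has to be supplied
separately in each case. -/
theorem isZeroTraceRep_comp₂ {F : ℝ → ℝ → ℝ} (hF : Continuous (Function.uncurry F))
    (h0 : F 0 0 = 0) {u v f g w : E n → ℝ} (hu : IsZeroTraceRep Ω s q p u f)
    (hv : IsZeroTraceRep Ω s q p v g) (hw : MemWTilde Ω s q p fun x => F (f x) (g x))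
    (hae : w =ᵐ[leb Ω] fun x => F (u x) (v x)) :
    IsZeroTraceRep Ω s q p w fun x => F (f x) (g x) := by
  obtain ⟨hf1, -, hf3, hf4⟩ := hu
  obtain ⟨hg1, -, hg3, hg4⟩ := hv
  refine ⟨H.isQuasicontinuous_comp₂ hF hf1 hg1, hw, ?_, H.isZeroOutside_comp₂ h0 hf4 hg4⟩
  filter_upwards [hf3, hg3, hae] with x h1 h2 h3
  rw [h1, h2, h3]

/-- The zero trace space as a linear subspace. -/
def zeroTrace (H : Bounds Ω q p a b) (s : ℝ) : Submodule ℝ (E n →ₘ[leb Ω] ℝ) where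
  carrier := zeroTraceSpace Ω s q p
  zero_mem' := by
    refine ⟨0, H.isQuasicontinuous_iff.2 fun ε hε => ⟨∅, ⟨∅, isOpen_empty, by simp⟩,
      ⟨0, (H.wTilde s).zero_mem, ae_of_all _ fun _ => le_rfl, ae_of_all _ fun _ h => h.elim, ?_⟩,
      continuousOn_const⟩, (H.wTilde s).zero_mem, AEEqFun.coeFn_zero.symm, ∅, empty_subset _, ?_,
      fun _ _ => rfl⟩
    · rwa [modularNorm_eq_lux, (H.mod s).lux_zero]
    · refine le_antisymm ((iInf₂_le ∅ ⟨⟨∅, isOpen_empty, by simp⟩, subset_rfl⟩).trans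
        ((iInf₂_le 0 ⟨(H.wTilde s).zero_mem, ae_of_all _ fun _ h => h.elim⟩).trans ?_)) zero_le
      rw [(H.mod s).map_zero]
  add_mem' := by
    rintro u v ⟨f, hf⟩ ⟨g, hg⟩
    exact ⟨_, H.isZeroTraceRep_comp₂ (F := fun x y => x + y) continuous_add (add_zero 0) hf hg
      ((H.wTilde s).add_mem hf.2.1 hg.2.1) (AEEqFun.coeFn_add u v)⟩
  smul_mem' := by
    rintro c u ⟨f, hf⟩
    exact ⟨_, H.isZeroTraceRep_comp₂ (F := fun x _ => c * x)
      (continuous_const.mul continuous_fst) (mul_zero c) hf hf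
      ((H.wTilde s).smul_mem c hf.2.1) (AEEqFun.coeFn_smul c u)⟩

theorem sup_mem_zeroTrace {u v : E n →ₘ[leb Ω] ℝ} (hu : u ∈ H.zeroTrace s)
    (hv : v ∈ H.zeroTrace s) : u ⊔ v ∈ H.zeroTrace s := by
  obtain ⟨f, hf⟩ := hu
  obtain ⟨g, hg⟩ := hv
  exact ⟨_, H.isZeroTraceRep_comp₂ (F := fun x y => x ⊔ y) continuous_sup (max_self 0) hf hg
    (H.memWTilde_sup hf.2.1 hg.2.1) (AEEqFun.coeFn_sup u v)⟩

theorem inf_mem_zeroTrace {u v : E n →ₘ[leb Ω] ℝ} (hu : u ∈ H.zeroTrace s)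
    (hv : v ∈ H.zeroTrace s) : u ⊓ v ∈ H.zeroTrace s := by
  obtain ⟨f, hf⟩ := hu
  obtain ⟨g, hg⟩ := hv
  have h : f ⊓ g ∈ H.wTilde s := by
    have := (H.wTilde s).sub_mem ((H.wTilde s).add_mem hf.2.1 hg.2.1)
      (H.memWTilde_sup hf.2.1 hg.2.1)
    rwa [show f ⊓ g = f + g - f ⊔ g by rw [← inf_add_sup, add_sub_cancel_right]]
  exact ⟨_, H.isZeroTraceRep_comp₂ (F := fun x y => x ⊓ y) continuous_inf (min_self 0) hf hg
    h (AEEqFun.coeFn_inf u v)⟩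

theorem coe_mem_dom {u : E n →ₘ[leb Ω] ℝ} (hu : u ∈ H.zeroTrace s) : ⇑u ∈ H.dom s := by
  obtain ⟨f, hf⟩ := hu
  exact H.mem_dom_congr_ae hf.2.2.1 (H.wTilde_le hf.2.1)

theorem modularNorm_coeFn_add (u v : E n →ₘ[leb Ω] ℝ) :
    modularNorm Ω s q p ⇑(u + v) = modularNorm Ω s q p (⇑u + ⇑v) :=
  H.modularNorm_congr_ae (AEEqFun.coeFn_add u v)

theorem modularNorm_coeFn_sub (u v : E n →ₘ[leb Ω] ℝ) :
    modularNorm Ω s q p ⇑(u - v) = modularNorm Ω s q p (⇑u - ⇑v) :=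
  H.modularNorm_congr_ae (AEEqFun.coeFn_sub u v)

theorem eq_zero_of_modularNorm {u : E n →ₘ[leb Ω] ℝ} (hu : u ∈ H.zeroTrace s)
    (h : modularNorm Ω s q p u = 0) : u = 0 :=
  AEEqFun.ext ((H.ae_eq_zero_of_modularNorm (H.coe_mem_dom hu) h).trans AEEqFun.coeFn_zero.symm)

theorem core_modularNorm :
    NormedSpace.Core ℝ (NormedBy (H.zeroTrace s) fun u => modularNorm Ω s q p u) := by
  refine normedSpaceCore_normedBy (fun u _ => modularNorm_nonneg _ _ _ _ _) (fun u hu c => ?_)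
    (fun u hu v hv => ?_) fun u hu h => H.eq_zero_of_modularNorm hu h
  · rw [H.modularNorm_congr_ae (AEEqFun.coeFn_smul c u), H.modularNorm_smul (H.coe_mem_dom hu)]
  · rw [H.modularNorm_coeFn_add]
    exact H.modularNorm_add_le (H.coe_mem_dom hu) (H.coe_mem_dom hv)

theorem core_sumNorm :
    NormedSpace.Core ℝ (NormedBy (H.zeroTrace s) fun u => sumNorm Ω s q p u) := by
  refine normedSpaceCore_normedBy (fun u _ => ?_) (fun u hu c => ?_)
    (fun u hu v hv => ?_) fun u hu h => H.eq_zero_of_modularNorm hu (le_antisymm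
      ((H.modularNorm_le_sumNorm (H.coe_mem_dom hu)).trans_eq h) (modularNorm_nonneg _ _ _ _ _))
  · rw [sumNorm_eq_lux]
    exact add_nonneg (lux_nonneg _ _) (lux_nonneg _ _)
  · have hd := H.coe_mem_dom hu
    rw [H.sumNorm_congr_ae (AEEqFun.coeFn_smul c u), sumNorm_eq_lux, sumNorm_eq_lux,
      H.modQ.lux_smul (H.dom_le_domQ s hd), (H.modP s).lux_smul (H.dom_le_domP s hd), mul_add]
  · have hd := H.coe_mem_dom hu
    have hd' := H.coe_mem_dom hv
    rw [H.sumNorm_congr_ae (AEEqFun.coeFn_add u v)]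
    simp only [sumNorm_eq_lux]
    have h1 := H.modQ.lux_add_le (H.dom_le_domQ s hd) (H.dom_le_domQ s hd')
    have h2 := (H.modP s).lux_add_le (H.dom_le_domP s hd) (H.dom_le_domP s hd')
    linarith

theorem exists_limit_mem_zeroTrace {u : ℕ → E n →ₘ[leb Ω] ℝ} (hu : ∀ k, u k ∈ H.zeroTrace s)
    (hl : ∀ k, modularNorm Ω s q p ⇑(u (k + 1) - u k) < (1 / 64) ^ (k + 1)) :
    ∃ v ∈ H.zeroTrace s, Tendsto (fun k => modularNorm Ω s q p ⇑(u k - v)) atTop (𝓝 0) := by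
  choose w hw using hu
  have hdiff : ∀ (k : ℕ) (v : E n →ₘ[leb Ω] ℝ) (f : E n → ℝ), v =ᵐ[leb Ω] f →
      modularNorm Ω s q p ⇑(v - u k) = modularNorm Ω s q p (f - w k) := fun k v f hf => by
    rw [H.modularNorm_coeFn_sub]
    exact H.modularNorm_congr_ae (hf.sub (hw k).2.2.1.symm)
  obtain ⟨f, hfq, hfW, hfz, hfl⟩ := H.exists_limit_zeroTrace (fun k => (hw k).1)
    (fun k => (hw k).2.1) (fun k => (hw k).2.2.2) fun k => by
      rw [← hdiff k (u (k + 1)) (w (k + 1)) (hw (k + 1)).2.2.1.symm]; exact hl k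
  have hfm : AEStronglyMeasurable f (leb Ω) :=
    (mem_aeMeas.1 (H.wTilde_le hfW).1).aestronglyMeasurable
  refine ⟨AEEqFun.mk f hfm, ⟨f, hfq, hfW, (AEEqFun.coeFn_mk f hfm).symm, hfz⟩, ?_⟩
  have hlim : Tendsto (fun k : ℕ => 2 * (1 / 4 : ℝ) ^ k) atTop (𝓝 0) := by
    simpa using (tendsto_pow_atTop_nhds_zero_of_lt_one (r := (1 / 4 : ℝ)) (by norm_num)
      (by norm_num)).const_mul 2
  refine squeeze_zero (fun k => modularNorm_nonneg _ _ _ _ _) (fun k => ?_) hlim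
  rw [H.modularNorm_coeFn_sub, H.modularNorm_sub_comm, ← H.modularNorm_coeFn_sub,
    hdiff k _ f (AEEqFun.coeFn_mk f hfm)]
  exact hfl k

theorem memLp_signedPow_q (u : H.zeroTrace s) :
    MemLp (fun x => signedPow (q x) (u.1 x)) 1 (leb Ω) :=
  memLp_signedPow H.qm H.q_pos (H.coe_mem_dom u.2).1 (H.dom_le_domQ s (H.coe_mem_dom u.2)).2

theorem memLp_signedPow_p (u : H.zeroTrace s) :
    MemLp (fun z => signedPow (p z) (gagQuot s p u.1 z)) 1 (leb₂ Ω) :=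
  memLp_signedPow H.pm H.p_pos (H.gagQuot_mem_dom s (H.coe_mem_dom u.2)).1
    (H.gagQuot_mem_dom s (H.coe_mem_dom u.2)).2

/-- The image of a class under the odd powers, in `L¹(Ω) × L¹(Ω × Ω)`. -/
def toLpOne (H : Bounds Ω q p a b) (s : ℝ) (u : H.zeroTrace s) :
    Lp ℝ 1 (leb Ω) × Lp ℝ 1 (leb₂ Ω) :=
  ((H.memLp_signedPow_q u).toLp _, (H.memLp_signedPow_p u).toLp _)

theorem modular_sub_le_edist (u v : H.zeroTrace s) :
    modular Ω s q p (⇑u.1 - ⇑v.1) ≤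
      2 * ENNReal.ofReal (2 ^ b) * edist (H.toLpOne s u) (H.toLpOne s v) := by
  have h1 := lebModular_sub_le_eLpNorm (b := b)
    (H.qb.mono fun x hx => ⟨H.one_lt.le.trans hx.1, hx.2⟩) ⇑u.1 ⇑v.1
  have h2 := lebModular_sub_le_eLpNorm (b := b)
    (H.pb.mono fun x hx => ⟨H.one_lt.le.trans hx.1, hx.2⟩) (gagQuot s p ⇑u.1) (gagQuot s p ⇑v.1)
  rw [H.modular_eq, map_sub, mul_assoc, two_mul]
  refine add_le_add (h1.trans (mul_le_mul_right ?_ _)) (h2.trans (mul_le_mul_right ?_ _))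
  · rw [← Lp.edist_toLp_toLp _ _ (H.memLp_signedPow_q u) (H.memLp_signedPow_q v)]
    exact le_max_left _ _
  · rw [← Lp.edist_toLp_toLp _ _ (H.memLp_signedPow_p u) (H.memLp_signedPow_p v)]
    exact le_max_right _ _

theorem modularNorm_sub_lt_of_edist {ε : ℝ} (hε : 0 < ε) : ∃ δ : ℝ≥0∞, 0 < δ ∧
    ∀ u v : H.zeroTrace s, edist (H.toLpOne s u) (H.toLpOne s v) < δ →
      modularNorm Ω s q p ⇑(u.1 - v.1) < ε := by
  set t := min ε 1 / 2 with ht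
  have ht0 : 0 < t := by positivity
  have ht1 : t < ε := by have := min_le_left ε 1; linarith
  have ht2 : t ≤ 1 := by have := min_le_right ε 1; linarith
  have hC : 2 * ENNReal.ofReal (2 ^ b) ≠ ∞ :=
    ENNReal.mul_ne_top ENNReal.ofNat_ne_top ENNReal.ofReal_ne_top
  have hC0 : 2 * ENNReal.ofReal (2 ^ b) ≠ 0 :=
    mul_ne_zero two_ne_zero (ENNReal.ofReal_pos.2 (by positivity)).ne'
  -- The threshold undoes the constant of `modular_sub_le_edist`, so that the modular of the
  -- difference is at most `t ^ b` and its norm at most `t < ε`.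
  refine ⟨ENNReal.ofReal (t ^ b) / (2 * ENNReal.ofReal (2 ^ b)),
    ENNReal.div_pos (ENNReal.ofReal_pos.2 (by positivity)).ne' hC, fun u v huv => ?_⟩
  rw [H.modularNorm_coeFn_sub, modularNorm_eq_lux]
  refine lt_of_le_of_lt ((H.mod s).lux_le_of_le
    ((H.dom s).sub_mem (H.coe_mem_dom u.2) (H.coe_mem_dom v.2)).1 ht0 ht2 ?_) ht1
  refine (H.modular_sub_le_edist u v).trans ((mul_le_mul_right huv.le _).trans ?_)
  rw [ENNReal.mul_div_cancel hC0 hC]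

theorem completeSpace_modularNorm :
    letI := NormedAddCommGroup.ofCore (H.core_modularNorm (s := s))
    CompleteSpace (NormedBy (H.zeroTrace s) fun u => modularNorm Ω s q p u) :=
  completeSpace_normedBy _ fun _ hu hl => H.exists_limit_mem_zeroTrace hu hl

theorem separableSpace_modularNorm :
    letI := NormedAddCommGroup.ofCore (H.core_modularNorm (s := s))
    TopologicalSpace.SeparableSpace (NormedBy (H.zeroTrace s) fun u => modularNorm Ω s q p u) := by
  have : Fact ((1 : ℝ≥0∞) ≠ ∞) := ⟨ENNReal.one_ne_top⟩
  have : MeasurableSpace.CountablyGenerated (E n × E n) := inferInstance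
  have : SFinite (leb₂ Ω) := inferInstance
  exact separableSpace_normedBy _ (H.toLpOne s) fun _ hε => H.modularNorm_sub_lt_of_edist hε

theorem uniformConvexSpace_modularNorm :
    letI := NormedAddCommGroup.ofCore (H.core_modularNorm (s := s))
    UniformConvexSpace (NormedBy (H.zeroTrace s) fun u => modularNorm Ω s q p u) := by
  refine uniformConvexSpace_normedBy _ fun ε hε => ?_
  obtain ⟨δ, hδ, hlt⟩ := (H.mod s).lux_uniformConvex hε
  refine ⟨δ, hδ, fun u hu v hv h1 h2 h3 => ?_⟩
  rw [H.modularNorm_coeFn_sub] at h3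
  rw [H.modularNorm_coeFn_add]
  rw [modularNorm_eq_lux] at h1 h2 h3 ⊢
  exact hlt _ (H.coe_mem_dom hu) _ (H.coe_mem_dom hv) h1 h2 h3

theorem isSeparableReflexiveBanach_modularNorm :
    IsSeparableReflexiveBanach (H.zeroTrace s) fun u => modularNorm Ω s q p u :=
  isSeparableReflexiveBanach_of_uniformConvex _ H.completeSpace_modularNorm
    H.separableSpace_modularNorm H.uniformConvexSpace_modularNorm

end Bounds

end FracSobolev

end

theorem mainTheorem8 (n : ℕ) (Ω : Set (FracSobolev.E n)) (hΩ : IsOpen Ω)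
    (s : ℝ) (hs0 : 0 < s) (hs1 : s < 1)
    (q : FracSobolev.E n → ℝ) (hq : FracSobolev.IsExponent (FracSobolev.leb Ω) q)
    (p : FracSobolev.E n × FracSobolev.E n → ℝ)
    (hp : FracSobolev.IsExponent (FracSobolev.leb₂ Ω) p) :
    ∃ S : Submodule ℝ (FracSobolev.E n →ₘ[FracSobolev.leb Ω] ℝ),
      -- the zero trace space is a linear space and a lattice
      (S : Set (FracSobolev.E n →ₘ[FracSobolev.leb Ω] ℝ)) =
        FracSobolev.zeroTraceSpace Ω s q p ∧
      (∀ u ∈ S, ∀ v ∈ S, u ⊔ v ∈ S ∧ u ⊓ v ∈ S) ∧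
      -- its two norms may be computed from any quasicontinuous representative
      (∀ u ∈ S, ∀ w : FracSobolev.E n → ℝ, FracSobolev.IsZeroTraceRep Ω s q p u w →
        FracSobolev.sumNorm Ω s q p u = FracSobolev.sumNorm Ω s q p w ∧
        FracSobolev.modularNorm Ω s q p u = FracSobolev.modularNorm Ω s q p w) ∧
      -- the two norms are equivalent
      (∀ u ∈ S, FracSobolev.modularNorm Ω s q p u ≤ FracSobolev.sumNorm Ω s q p u ∧
        FracSobolev.sumNorm Ω s q p u ≤ 2 * FracSobolev.modularNorm Ω s q p u) ∧
      FracSobolev.IsSeparableReflexiveBanach S (fun u => FracSobolev.sumNorm Ω s q p u) ∧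
      FracSobolev.IsSeparableReflexiveBanach S (fun u => FracSobolev.modularNorm Ω s q p u) ∧
      FracSobolev.IsUniformlyConvex S (fun u => FracSobolev.modularNorm Ω s q p u) := by
  obtain ⟨a, b, H⟩ := FracSobolev.exists_bounds hq hp
  have hle : ∀ u ∈ H.zeroTrace s,
      FracSobolev.modularNorm Ω s q p u ≤ FracSobolev.sumNorm Ω s q p u ∧
      FracSobolev.sumNorm Ω s q p u ≤ 2 * FracSobolev.modularNorm Ω s q p u := fun u hu =>
    ⟨H.modularNorm_le_sumNorm (H.coe_mem_dom hu), H.sumNorm_le_modularNorm (H.coe_mem_dom hu)⟩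
  refine ⟨H.zeroTrace s, rfl,
    fun u hu v hv => ⟨H.sup_mem_zeroTrace hu hv, H.inf_mem_zeroTrace hu hv⟩,
    fun u _ w hw => ⟨H.sumNorm_congr_ae hw.2.2.1.symm, H.modularNorm_congr_ae hw.2.2.1.symm⟩,
    hle, ?_, H.isSeparableReflexiveBanach_modularNorm,
    H.core_modularNorm, H.uniformConvexSpace_modularNorm⟩
  -- Reflexivity, unlike uniform convexity, passes to an equivalent norm; the constants are `2` and
  -- `1`.
  exact H.isSeparableReflexiveBanach_modularNorm.of_equivalent H.core_sumNorm
    (fun u hu => (hle u hu).2) fun u hu => ((hle u hu).1.trans_eq (one_mul _).symm)
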